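/- Let $n\ge 1$ and let $(M,\omega)$ be an $n$-plectic manifold: $M$ is a (finite-dimensional, smooth, real) manifold and $\omega\in\Omega^{n+1}(M)$ is closed and such that $T_pM\to\Lambda^nT_p^*M$, $V\mapsto V\lrcorner\,\omega$, is injective for every $p\in M$. For decomposable multivector fields put $(X_1\wedge\cdots\wedge X_k)\lrcorner\,\tau=X_k\lrcorner\cdots\lrcorner X_1\lrcorner\,\tau$, and extend linearly. For $1\le k\le n$ let $$\Omega^{n-k}_{\mathrm{Ham}}(M)=\{\alpha\in\Omega^{n-k}(M)\;:\;\exists\,X\in\Gamma(\Lambda^kTM),\ d\alpha=-X\lrcorner\,\omega\}.$$ For $\alpha\in\Omega^{n-1}_{\mathrm{Ham}}(M)$ let $X_\alpha$ denote the unique vector field with $d\alpha=-X_\alpha\lrcorner\,\omega$. An $L_\infty$-algebra is a graded vector space $L=\bigoplus_{i\in\mathbb Z}L_i$ with graded skew-symmetric multilinear maps $l_k:L^{\otimes k}\to L$, $k\ge1$, of degree $k-2$, such that for all $m\ge1$ and all homogeneous $x_1,\dots,x_m$ $$\sum_{i+j=m+1}\ \sum_{\sigma\in \mathrm{Sh}(i,m-i)}(-1)^\sigma\epsilon(\sigma)(-1)^{i(j-1)}\,l_j\bigl(l_i(x_{\sigma(1)},\dots,x_{\sigma(i)}),x_{\sigma(i+1)},\dots,x_{\sigma(m)}\bigr)=0,$$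 where $i,j\ge 1$, $\mathrm{Sh}(i,m-i)$ is the set of $(i,m-i)$-unshuffles, $(-1)^\sigma$ is the sign of $\sigma$ and $\epsilon(\sigma)$ is its Koszul sign. It is a Lie $n$-algebra if $L_i=0$ for $i\ge n$. An $L_\infty$-subalgebra is a graded subspace closed under all $l_k$. The Lie $n$-algebra of observables $(L,\{l_k\})$ of $(M,\omega)$ is given by $L_0=\Omega^{n-1}_{\mathrm{Ham}}(M)$, $L_i=\Omega^{n-1-i}(M)$ for $1\le i\le n-1$, and $L_i=0$ otherwise. The map $l_1$ is $d$ in degrees $>0$ and is $0$ in degree $0$. For $k\ge2$, $$l_k(\alpha_1,\dots,\alpha_k)=-(-1)^{k(k+1)/2}\,X_{\alpha_k}\lrcorner\cdots\lrcorner X_{\alpha_1}\lrcorner\,\omega$$ if all the $\alpha_a$ have degree $0$, and $l_k$ vanishes on homogeneous arguments of positive total degree. Theorem. $(L,\{l_k\})$ is a Lie $n$-algebra, and the Hamiltonian forms $\widehat L=\bigoplus_{i=0}^{n-1}\widehat L_i$, $\widehat L_i=\Omega^{n-1-i}_{\mathrm{Ham}}(M)$, form an $L_\infty$-subalgebra of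 $(L,\{l_k\})$. Moreover, let $H\in\Omega^{n-1}_{\mathrm{Ham}}(M)$ with Hamiltonian vector field $X_H$, and call $\alpha\in\Omega^{n-k}_{\mathrm{Ham}}(M)$ locally, globally or strictly conserved if $\mathcal L_{X_H}\alpha$ is closed, exact or zero, respectively. Then the spaces $\mathcal C_{\mathrm{loc}}(X_H)\cap\widehat L$, $\mathcal C(X_H)\cap\widehat L$ and $\mathcal C_{\mathrm{str}}(X_H)\cap\widehat L$ of locally, globally and strictly conserved Hamiltonian forms are $L_\infty$-subalgebras of $(\widehat L,\{l_k\})$. -/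

import Mathlib

open scoped Manifold ContDiff Topology

noncomputable section

namespace Multisymplectic

/-! ## L∞-algebras -/

section LInfty

/-- The Koszul sign `ε(σ)` of a permutation of homogeneous elements of degrees `d`: every inversion
of `σ` contributes the sign `(-1)^{d d'}`, where `d` and `d'` are the two degrees involved. -/
def koszulSign {k : ℕ} (d : Fin k → ℤ) (σ : Equiv.Perm (Fin k)) : ℤˣ :=
  ∏ q : Fin k × Fin k with q.1 < q.2 ∧ σ q.2 < σ q.1, (d (σ q.1) * d (σ q.2)).negOnePow

/-- `σ` is an `(i, m - i)`-unshuffle: it is increasing on the first `i` letters and increasing on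
the last `m - i` letters. -/
def IsUnshuffle {m : ℕ} (i : ℕ) (σ : Equiv.Perm (Fin m)) : Prop :=
  ∀ a b : Fin m, a < b → ((b : ℕ) < i ∨ i ≤ (a : ℕ)) → σ a < σ b

variable {V : Type*} [AddCommGroup V] [Module ℝ V]

open Classical in
/-- The left-hand side of the `m`-th generalized Jacobi identity at homogeneous elements
`x₁, …, x_m` of degrees `d₁, …, d_m`, i.e. the sum over `i + j = m + 1` and over all
`(i, m - i)`-unshuffles `σ` of
`(-1)^σ ε(σ) (-1)^{i (j - 1)} l_j (l_i (x_{σ(1)}, …, x_{σ(i)}), x_{σ(i+1)}, …, x_{σ(m)})`.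
The summation index `i : Fin m` stands for the arity `i + 1`, so that `j - 1 = m - 1 - i`. -/
def jacobiator (l : (k : ℕ) → (Fin k → V) → V) {m : ℕ} (d : Fin m → ℤ) (x : Fin m → V) : V :=
  ∑ i : Fin m, ∑ σ : Equiv.Perm (Fin m) with IsUnshuffle (i + 1) σ,
    (Equiv.Perm.sign σ * koszulSign d σ * (-1) ^ (((i : ℕ) + 1) * (m - 1 - i)) : ℤˣ) •
      l (m - 1 - i + 1)
        (Fin.cons (l (i + 1) fun a : Fin (i + 1) => x (σ ⟨a, by omega⟩))
          fun b : Fin (m - 1 - i) => x (σ ⟨i + 1 + b, by omega⟩))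

/-- `W = ⊕ᵢ Wᵢ` is closed under the operations `l_k`, `k ≥ 1`, with `l_k` of degree `k - 2`. -/
def IsClosedUnder (W : ℤ → Submodule ℝ V) (l : (k : ℕ) → (Fin k → V) → V) : Prop :=
  ∀ k : ℕ, 1 ≤ k → ∀ (d : Fin k → ℤ) (x : Fin k → V), (∀ a, x a ∈ W (d a)) →
    l k x ∈ W ((∑ a, d a) + k - 2)

/-- The graded vector space `L = ⊕ᵢ Lᵢ`, realized as an internal direct sum inside a vector space
`V`, is an L∞-algebra with the operations `l_k`, `k ≥ 1`. Only the values of `l_k` on `L` matter. -/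
structure IsLInftyAlgebra (L : ℤ → Submodule ℝ V) (l : (k : ℕ) → (Fin k → V) → V) : Prop where
  independent : iSupIndep L
  /-- each `l_k` is a map `L^k → L` of degree `k - 2` -/
  degree : IsClosedUnder L l
  /-- each `l_k` is multilinear on `L` -/
  multilinear : ∀ k : ℕ, 1 ≤ k → ∀ x : Fin k → V, (∀ a, x a ∈ ⨆ i, L i) →
    ∀ a : Fin k, ∀ y ∈ ⨆ i, L i, ∀ z ∈ ⨆ i, L i, ∀ c : ℝ,
      l k (Function.update x a (c • y + z)) =
        c • l k (Function.update x a y) + l k (Function.update x a z)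
  /-- each `l_k` is graded skew-symmetric -/
  skew : ∀ k : ℕ, 1 ≤ k → ∀ (d : Fin k → ℤ) (x : Fin k → V), (∀ a, x a ∈ L (d a)) →
    ∀ σ : Equiv.Perm (Fin k),
      l k (fun a => x (σ a)) = (Equiv.Perm.sign σ * koszulSign d σ : ℤˣ) • l k x
  jacobi : ∀ m : ℕ, 1 ≤ m → ∀ (d : Fin m → ℤ) (x : Fin m → V), (∀ a, x a ∈ L (d a)) →
    jacobiator l d x = 0

/-- A Lie `n`-algebra: an L∞-algebra with `Lᵢ = 0` for `i ≥ n`. -/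
structure IsLieNAlgebra (n : ℕ) (L : ℤ → Submodule ℝ V) (l : (k : ℕ) → (Fin k → V) → V) : Prop
    extends IsLInftyAlgebra L l where
  eq_bot : ∀ i : ℤ, (n : ℤ) ≤ i → L i = ⊥

/-- `W` is an L∞-subalgebra of the L∞-algebra `(L, l)`: a graded subspace of `L` that is closed
under all the operations. -/
structure IsLInftySubalgebra (W L : ℤ → Submodule ℝ V) (l : (k : ℕ) → (Fin k → V) → V) : Prop where
  ambient : IsLInftyAlgebra L l
  le : ∀ i, W i ≤ L i
  closed : IsClosedUnder W l

end LInfty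

/-! ## Differential forms and multivector fields on a manifold

`M` is a manifold without boundary modelled on `E`. In Mathlib the tangent space `T_xM` is a copy of
the model space `E`, so a form at `x` is an alternating form on `E`. -/

section Forms

variable (E : Type*) [NormedAddCommGroup E] [NormedSpace ℝ E]
  (M : Type*) [TopologicalSpace M] [ChartedSpace E M]

/-- Not necessarily smooth (inhomogeneous) differential forms; `η x p` is the component of
degree `p` at the point `x`. -/
abbrev RoughForm : Type _ := M → (p : ℕ) → E [⋀^Fin p]→L[ℝ] ℝ

variable {E M}

/-- The degree `p` component of a form, written in the chart at `x₀`, i.e. its pullback by the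
inverse of that chart. -/
def chartRep (x₀ : M) (p : ℕ) (η : RoughForm E M) (y : E) : E [⋀^Fin p]→L[ℝ] ℝ :=
  (η ((extChartAt 𝓘(ℝ, E) x₀).symm y) p).compContinuousLinearMap
    (mfderiv 𝓘(ℝ, E) 𝓘(ℝ, E) (extChartAt 𝓘(ℝ, E) x₀).symm y)

/-- A form is smooth if it is smooth in the charts. -/
def IsSmoothForm (η : RoughForm E M) : Prop :=
  ∀ (x₀ : M) (p : ℕ), ContDiffOn ℝ ∞ (chartRep x₀ p η) (extChartAt 𝓘(ℝ, E) x₀).target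

variable (E M) in
/-- The smooth differential forms on `M`, as a subspace. -/
def smoothForms : Submodule ℝ (RoughForm E M) where
  carrier := {η | IsSmoothForm η}
  zero_mem' := fun _ _ => contDiffOn_const (c := 0)
  add_mem' := fun ha hb x₀ p => (ha x₀ p).add (hb x₀ p)
  smul_mem' := fun c _ ha x₀ p => (ha x₀ p).const_smul c

variable (E M) in
/-- The space `Ω^•(M)` of smooth differential forms on `M`. -/
def DiffForm : Type _ := smoothForms E M

instance : AddCommGroup (DiffForm E M) := inferInstanceAs (AddCommGroup (smoothForms E M))

instance : Module ℝ (DiffForm E M) := inferInstanceAs (Module ℝ (smoothForms E M))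

theorem DiffForm.add_val (η θ : DiffForm E M) : (η + θ).1 = η.1 + θ.1 := rfl

theorem DiffForm.smul_val (c : ℝ) (η : DiffForm E M) : (c • η).1 = c • η.1 := rfl

variable (E M) in
/-- The space `Ω^j(M)` of smooth `j`-forms. It is zero for `j < 0`. -/
def formsOfDegree (j : ℤ) : Submodule ℝ (DiffForm E M) where
  carrier := {η | ∀ (x : M) (p : ℕ), (p : ℤ) ≠ j → η.1 x p = 0}
  zero_mem' := fun _ _ _ => rfl
  add_mem' := fun {η θ} hη hθ x p hp => by
    change η.1 x p + θ.1 x p = 0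
    rw [hη x p hp, hθ x p hp, add_zero]
  smul_mem' := fun c η hη x p hp => by
    change c • η.1 x p = 0
    rw [hη x p hp, smul_zero]

open Classical in
/-- The projection of `Ω^•(M)` onto the components whose degree lies in `S`. -/
def degreeProj (S : Set ℕ) : DiffForm E M →ₗ[ℝ] DiffForm E M where
  toFun η := ⟨fun x p => if p ∈ S then η.1 x p else 0, fun x₀ p => by
    by_cases hp : p ∈ S
    · exact (η.2 x₀ p).congr fun y _ => by simp only [chartRep, if_pos hp]
    · exact (contDiffOn_const (c := (0 : E [⋀^Fin p]→L[ℝ] ℝ))).congr fun y _ => by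
        simp only [chartRep, if_neg hp]; rfl⟩
  map_add' := fun η θ => by
    refine Subtype.ext (funext fun x => funext fun p => ?_)
    change (if p ∈ S then η.1 x p + θ.1 x p else 0) =
      (if p ∈ S then η.1 x p else 0) + (if p ∈ S then θ.1 x p else 0)
    split_ifs <;> simp
  map_smul' := fun c η => by
    refine Subtype.ext (funext fun x => funext fun p => ?_)
    change (if p ∈ S then c • η.1 x p else 0) = c • (if p ∈ S then η.1 x p else 0)
    split_ifs <;> simp

/-- The exterior derivative, computed at `x` in the chart at `x`. -/
def roughExtDeriv (η : RoughForm E M) : RoughForm E M := fun x p =>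
  match p with
  | 0 => 0
  | p + 1 =>
    (extDeriv (chartRep x p η) (extChartAt 𝓘(ℝ, E) x x)).compContinuousLinearMap
      (mfderiv 𝓘(ℝ, E) 𝓘(ℝ, E) (extChartAt 𝓘(ℝ, E) x) x)

/-- The exterior derivative can be computed in any chart. -/
theorem chartRep_roughExtDeriv [IsManifold 𝓘(ℝ, E) ∞ M] {η : RoughForm E M} (hη : IsSmoothForm η)
    (x₀ : M) (p : ℕ) {y : E} (hy : y ∈ (extChartAt 𝓘(ℝ, E) x₀).target) :
    chartRep x₀ (p + 1) (roughExtDeriv η) y = extDeriv (chartRep x₀ p η) y := by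
  set x : M := (extChartAt 𝓘(ℝ, E) x₀).symm y with hx
  have : IsManifold 𝓘(ℝ, E) 1 M := IsManifold.of_le (n := ∞) (by exact_mod_cast le_top)
  have hxs : x ∈ (extChartAt 𝓘(ℝ, E) x₀).source := (extChartAt 𝓘(ℝ, E) x₀).map_target hy
  have hyx : extChartAt 𝓘(ℝ, E) x₀ x = y := (extChartAt 𝓘(ℝ, E) x₀).right_inv hy
  have hot : ∀ z : M, IsOpen (extChartAt 𝓘(ℝ, E) z).target := fun z => isOpen_extChartAt_target z
  -- the transition map
  let g : E → E := fun y' => extChartAt 𝓘(ℝ, E) x ((extChartAt 𝓘(ℝ, E) x₀).symm y')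
  have hsymm : ∀ (z : M) (y' : E), y' ∈ (extChartAt 𝓘(ℝ, E) z).target →
      ContMDiffAt 𝓘(ℝ, E) 𝓘(ℝ, E) ∞ (extChartAt 𝓘(ℝ, E) z).symm y' := fun z y' h =>
    (contMDiffOn_extChartAt_symm (I := 𝓘(ℝ, E)) (n := ∞) z).contMDiffAt ((hot z).mem_nhds h)
  have hchart : ∀ (z z' : M), z' ∈ (extChartAt 𝓘(ℝ, E) z).source →
      ContMDiffAt 𝓘(ℝ, E) 𝓘(ℝ, E) ∞ (extChartAt 𝓘(ℝ, E) z) z' := fun z z' h =>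
    contMDiffAt_extChartAt' (by simpa using h)
  have hnear : ∀ᶠ y' in 𝓝 y, y' ∈ (extChartAt 𝓘(ℝ, E) x₀).target ∧
      (extChartAt 𝓘(ℝ, E) x₀).symm y' ∈ (extChartAt 𝓘(ℝ, E) x).source := by
    refine ((hot x₀).mem_nhds hy |> Filter.Eventually.and <| ?_)
    exact (hsymm x₀ y hy).continuousAt.eventually (extChartAt_source_mem_nhds (I := 𝓘(ℝ, E)) x)
  have hg : ∀ y', y' ∈ (extChartAt 𝓘(ℝ, E) x₀).target →
      (extChartAt 𝓘(ℝ, E) x₀).symm y' ∈ (extChartAt 𝓘(ℝ, E) x).source → ContDiffAt ℝ ∞ g y' := by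
    intro y' h1 h2
    exact contMDiffAt_iff_contDiffAt.1 ((hchart x _ h2).comp y' (hsymm x₀ y' h1))
  have key : chartRep x₀ p η =ᶠ[𝓝 y] fun y' =>
      (chartRep x p η (g y')).compContinuousLinearMap (fderiv ℝ g y') := by
    filter_upwards [hnear.and (eventually_eventually_nhds.2 hnear)] with y' ⟨⟨h1, h2⟩, h3⟩
    have hleft : (extChartAt 𝓘(ℝ, E) x).symm (g y') = (extChartAt 𝓘(ℝ, E) x₀).symm y' :=
      (extChartAt 𝓘(ℝ, E) x).left_inv h2
    have hgt : g y' ∈ (extChartAt 𝓘(ℝ, E) x).target := (extChartAt 𝓘(ℝ, E) x).map_source h2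
    have hcomp : mfderiv 𝓘(ℝ, E) 𝓘(ℝ, E) (extChartAt 𝓘(ℝ, E) x₀).symm y' =
        (mfderiv 𝓘(ℝ, E) 𝓘(ℝ, E) (extChartAt 𝓘(ℝ, E) x).symm (g y')).comp
          (mfderiv 𝓘(ℝ, E) 𝓘(ℝ, E) g y') := by
      rw [← mfderiv_comp y' ((hsymm x _ hgt).mdifferentiableAt (by simp))
        (contMDiffAt_iff_contDiffAt.2 (hg y' h1 h2) |>.mdifferentiableAt (by simp))]
      refine Filter.EventuallyEq.mfderiv_eq ?_
      filter_upwards [h3] with y'' ⟨_, h5⟩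
      exact ((extChartAt 𝓘(ℝ, E) x).left_inv h5).symm
    have hgen : ∀ (m m' : M) (A B : E →L[ℝ] E), m' = m → A = B →
        (η m p).compContinuousLinearMap A = (η m' p).compContinuousLinearMap B := by
      rintro m m' A B rfl rfl; rfl
    rw [← mfderiv_eq_fderiv]
    exact hgen _ _ _ _ hleft hcomp
  have hgx : g y = extChartAt 𝓘(ℝ, E) x x := rfl
  rw [key.extDeriv_eq, extDeriv_pullback (r := ∞) ?_ (hg y hy (mem_extChartAt_source x))
    (by simpa using (WithTop.coe_le_coe.2 le_top : ((2 : ℕ∞) : WithTop ℕ∞) ≤ ∞))]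
  · have hder : (fderiv ℝ g y : E →L[ℝ] E) =
        (mfderiv 𝓘(ℝ, E) 𝓘(ℝ, E) (extChartAt 𝓘(ℝ, E) x) x).comp
          (mfderiv 𝓘(ℝ, E) 𝓘(ℝ, E) (extChartAt 𝓘(ℝ, E) x₀).symm y) := by
      rw [← mfderiv_eq_fderiv]
      exact mfderiv_comp y ((hchart x x (mem_extChartAt_source x)).mdifferentiableAt (by simp))
        ((hsymm x₀ y hy).mdifferentiableAt (by simp))
    rw [hder]
    rfl
  · exact ((hη x p).contDiffAt ((hot x).mem_nhds (mem_extChartAt_target x))).differentiableAt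
      (by simp)


theorem chartRep_add (x₀ : M) (p : ℕ) (η θ : RoughForm E M) :
    chartRep x₀ p (η + θ) = chartRep x₀ p η + chartRep x₀ p θ := rfl

theorem chartRep_smul (x₀ : M) (p : ℕ) (c : ℝ) (η : RoughForm E M) :
    chartRep x₀ p (c • η) = c • chartRep x₀ p η := rfl

theorem contDiff_alternatize (p : ℕ) : ContDiff ℝ ∞
    (fun A : E →L[ℝ] E [⋀^Fin p]→L[ℝ] ℝ => ContinuousAlternatingMap.alternatizeUncurryFin A) :=
  show ContDiff ℝ ∞ ⇑(ContinuousAlternatingMap.alternatizeUncurryFinCLM ℝ E ℝ (n := p)) from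
    ContinuousLinearMap.contDiff _

theorem IsSmoothForm.roughExtDeriv [IsManifold 𝓘(ℝ, E) ∞ M] {η : RoughForm E M}
    (hη : IsSmoothForm η) : IsSmoothForm (roughExtDeriv η) := by
  rintro x₀ (_ | p)
  · exact contDiffOn_const (c := 0)
  · refine ContDiffOn.congr ?_ fun y hy => chartRep_roughExtDeriv hη x₀ p hy
    have h : ContDiffOn ℝ ∞ (fderiv ℝ (chartRep x₀ p η)) (extChartAt 𝓘(ℝ, E) x₀).target :=
      (hη x₀ p).fderiv_of_isOpen (isOpen_extChartAt_target x₀) (by simp)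
    exact (contDiff_alternatize p).comp_contDiffOn h

/-- The exterior derivative `d : Ω^•(M) → Ω^•(M)`. -/
def extD [IsManifold 𝓘(ℝ, E) ∞ M] : DiffForm E M →ₗ[ℝ] DiffForm E M where
  toFun η := ⟨roughExtDeriv η.1, η.2.roughExtDeriv⟩
  map_add' := by
    intro η θ
    have hd : ∀ (ζ : DiffForm E M) (x : M) (p : ℕ), DifferentiableAt ℝ (chartRep x p ζ.1)
        (extChartAt 𝓘(ℝ, E) x x) := fun ζ x p =>
      ((ζ.2 x p).contDiffAt ((isOpen_extChartAt_target x).mem_nhds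
        (mem_extChartAt_target x))).differentiableAt (by simp)
    refine Subtype.ext (funext fun x => funext fun p => ?_)
    cases p with
    | zero => exact (add_zero 0).symm
    | succ p =>
      have h := extDeriv_add (hd η x p) (hd θ x p)
      rw [← chartRep_add] at h
      have h' := congrArg (fun τ : E [⋀^Fin (p + 1)]→L[ℝ] ℝ => τ.compContinuousLinearMap
        (mfderiv 𝓘(ℝ, E) 𝓘(ℝ, E) (extChartAt 𝓘(ℝ, E) x) x : E →L[ℝ] E)) h
      exact h'
  map_smul' := by
    intro c η
    refine Subtype.ext (funext fun x => funext fun p => ?_)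
    cases p with
    | zero => exact (smul_zero c).symm
    | succ p =>
      have h := extDeriv_smul (x := extChartAt 𝓘(ℝ, E) x x) c (chartRep x p η.1)
      rw [← chartRep_smul] at h
      have h' := congrArg (fun τ : E [⋀^Fin (p + 1)]→L[ℝ] ℝ => τ.compContinuousLinearMap
        (mfderiv 𝓘(ℝ, E) 𝓘(ℝ, E) (extChartAt 𝓘(ℝ, E) x) x : E →L[ℝ] E)) h
      exact h'

variable (E M) in
/-- Smooth vector fields `Γ(TM)`. -/
abbrev VField [IsManifold 𝓘(ℝ, E) ∞ M] : Type _ :=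
  Cₛ^∞⟮𝓘(ℝ, E); E, fun x : M => TangentSpace 𝓘(ℝ, E) x⟯

/-- The interior product `v ⌟ τ` at a point: `(v ⌟ τ)(v₁, …, v_p) = τ(v, v₁, …, v_p)`, and
`v ⌟ τ = 0` for `τ` of degree `0`. -/
def contractVec : E →ₗ[ℝ] Module.End ℝ ((p : ℕ) → E [⋀^Fin p]→L[ℝ] ℝ) :=
  LinearMap.mk₂ ℝ (fun v τ p => (τ (p + 1)).curryLeft v)
    (fun v w τ => by ext p : 1; exact map_add _ v w)
    (fun c v τ => by ext p : 1; exact map_smul _ c v)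
    (fun v τ τ' => rfl) (fun c v τ => rfl)

theorem contractVec_contractVec (v : E) (τ : (p : ℕ) → E [⋀^Fin p]→L[ℝ] ℝ) :
    contractVec v (contractVec v τ) = 0 :=
  funext fun p => (τ (p + 2)).curryLeft_same v

/-- The contraction with multivectors at a point, the linear extension of
`(v₁ ∧ ⋯ ∧ v_k) ⌟ τ = v_k ⌟ ⋯ ⌟ v₁ ⌟ τ`. -/
def contractMulti :
    ExteriorAlgebra ℝ E →ₐ[ℝ] (Module.End ℝ ((p : ℕ) → E [⋀^Fin p]→L[ℝ] ℝ))ᵐᵒᵖ :=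
  ExteriorAlgebra.lift ℝ
    ⟨(MulOpposite.opLinearEquiv ℝ).toLinearMap ∘ₗ contractVec, fun v =>
      MulOpposite.unop_injective (LinearMap.ext fun τ => contractVec_contractVec v τ)⟩

open VectorField in
theorem isSmoothForm_contract [IsManifold 𝓘(ℝ, E) ∞ M] [FiniteDimensional ℝ E] (X : VField E M)
    {η : RoughForm E M} (hη : IsSmoothForm η) :
    IsSmoothForm (fun x => contractVec (E := E) (X x) (η x)) := by
  have : CompleteSpace E := FiniteDimensional.complete ℝ E
  have : IsManifold 𝓘(ℝ, E) 1 M := IsManifold.of_le (n := ∞) (by exact_mod_cast le_top)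
  intro x₀ p
  set ψ := (extChartAt 𝓘(ℝ, E) x₀).symm with hψ
  let Xr : E → E := fun y =>
    mpullbackWithin 𝓘(ℝ, E) 𝓘(ℝ, E) ψ (fun x => X x) (Set.range 𝓘(ℝ, E)) y
  have hX : ContDiffOn ℝ ∞ Xr (extChartAt 𝓘(ℝ, E) x₀).target := by
    intro y hy
    have h := ContMDiffWithinAt.mpullbackWithin_vectorField_inter (I := 𝓘(ℝ, E)) (I' := 𝓘(ℝ, E))
      (f := ψ) (s := Set.range 𝓘(ℝ, E)) (t := Set.univ) (x₀ := y) (m := ∞) (n := ∞)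
      (V := fun x => X x) (X.contMDiff (ψ y)).contMDiffWithinAt
      (((contMDiffOn_extChartAt_symm (I := 𝓘(ℝ, E)) (n := ∞) x₀).contMDiffAt
        ((isOpen_extChartAt_target x₀).mem_nhds hy)).contMDiffWithinAt)
      (isInvertible_mfderivWithin_extChartAt_symm hy) (by simp) (by simpa using uniqueMDiffOn_univ)
      (by simp)
    have h2 := (contMDiffWithinAt_vectorSpace_iff_contDiffWithinAt (V := Xr)).1 h
    exact h2.mono (by simp)
  have hrep : ∀ y ∈ (extChartAt 𝓘(ℝ, E) x₀).target,
      chartRep x₀ p (fun x => contractVec (E := E) (X x) (η x)) y =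
        (chartRep x₀ (p + 1) η y).curryLeft (Xr y) := by
    intro y hy
    have hinv := isInvertible_mfderivWithin_extChartAt_symm (I := 𝓘(ℝ, E)) hy
    have h0 : mfderiv 𝓘(ℝ, E) 𝓘(ℝ, E) ψ y (Xr y) = X (ψ y) := by
      have := hinv.self_apply_inverse (X (ψ y))
      simp only [modelWithCornersSelf_coe, Set.range_id, mfderivWithin_univ] at this
      simp only [Xr, mpullbackWithin, modelWithCornersSelf_coe, Set.range_id, mfderivWithin_univ]
      exact this
    unfold chartRep
    erw [ContinuousAlternatingMap.curryLeft_compContinuousLinearMap]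
    erw [h0]
    rfl
  refine ContDiffOn.congr ?_ hrep
  have h1 : ContDiffOn ℝ ∞ (fun y => (chartRep x₀ (p + 1) η y).curryLeft)
      (extChartAt 𝓘(ℝ, E) x₀).target :=
    (show ContDiff ℝ ∞ ⇑(ContinuousAlternatingMap.curryLeftLI (𝕜 := ℝ) (E := E) (F := ℝ) (n := p))
      from LinearIsometry.contDiff _).comp_contDiffOn (hη x₀ (p + 1))
  exact h1.clm_apply hX

/-- The interior product `X ⌟ τ` of a form with a vector field. -/
def contract [IsManifold 𝓘(ℝ, E) ∞ M] [FiniteDimensional ℝ E] (X : VField E M) :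
    DiffForm E M →ₗ[ℝ] DiffForm E M where
  toFun η := ⟨fun x => contractVec (E := E) (X x) (η.1 x), isSmoothForm_contract X η.2⟩
  map_add' := fun η θ => Subtype.ext <| funext fun x =>
    map_add (contractVec (E := E) (X x)) (η.1 x) (θ.1 x)
  map_smul' := fun c η => Subtype.ext <| funext fun x =>
    map_smul (contractVec (E := E) (X x)) c (η.1 x)

/-- The Lie derivative `𝓛_X τ = d(X ⌟ τ) + X ⌟ dτ`. -/
def lieDeriv [IsManifold 𝓘(ℝ, E) ∞ M] [FiniteDimensional ℝ E] (X : VField E M) :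
    DiffForm E M →ₗ[ℝ] DiffForm E M :=
  extD ∘ₗ contract X + contract X ∘ₗ extD

variable (E M) in
/-- Smooth `k`-vector fields `Γ(Λ^k(TM))`: near every point, a finite sum of terms
`f X₁ ∧ ⋯ ∧ X_k` with a smooth function `f` and smooth vector fields `X₁, …, X_k`. -/
def MultiVField [IsManifold 𝓘(ℝ, E) ∞ M] (k : ℕ) :
    Submodule ℝ (M → ExteriorAlgebra ℝ E) where
  carrier := {P | ∀ x₀ : M, ∃ U : Set M, IsOpen U ∧ x₀ ∈ U ∧
    ∃ (N : ℕ) (f : Fin N → M → ℝ) (X : Fin N → Fin k → (x : M) → TangentSpace 𝓘(ℝ, E) x),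
      (∀ a, ContMDiffOn 𝓘(ℝ, E) 𝓘(ℝ, ℝ) ∞ (f a) U) ∧
      (∀ a i, ContMDiffOn 𝓘(ℝ, E) 𝓘(ℝ, E).tangent ∞
        (fun x => (⟨x, X a i x⟩ : TangentBundle 𝓘(ℝ, E) M)) U) ∧
      ∀ x ∈ U, P x = ∑ a, f a x • ExteriorAlgebra.ιMulti ℝ k (M := E) (fun i => X a i x)}
  zero_mem' := fun x₀ => ⟨Set.univ, isOpen_univ, trivial, 0, Fin.elim0, Fin.elim0,
    fun a => a.elim0, fun a => a.elim0, fun x _ => by simp⟩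
  add_mem' := by
    rintro P Q hP hQ x₀
    obtain ⟨U, hU, hxU, N, f, X, hf, hX, hPX⟩ := hP x₀
    obtain ⟨U', hU', hxU', N', f', X', hf', hX', hQX⟩ := hQ x₀
    refine ⟨U ∩ U', hU.inter hU', ⟨hxU, hxU'⟩, N + N', Fin.append f f', Fin.append X X', ?_, ?_, ?_⟩
    · intro a
      refine Fin.addCases (fun b => ?_) (fun b => ?_) a
      · rw [Fin.append_left]; exact (hf b).mono Set.inter_subset_left
      · rw [Fin.append_right]; exact (hf' b).mono Set.inter_subset_right
    · intro a
      refine Fin.addCases (fun b => ?_) (fun b => ?_) a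
      · rw [Fin.append_left]; exact fun i => (hX b i).mono Set.inter_subset_left
      · rw [Fin.append_right]; exact fun i => (hX' b i).mono Set.inter_subset_right
    · intro x hx
      rw [Fin.sum_univ_add]
      simp only [Fin.append_left, Fin.append_right]
      rw [← hPX x hx.1, ← hQX x hx.2]
      rfl
  smul_mem' := by
    rintro c P hP x₀
    obtain ⟨U, hU, hxU, N, f, X, hf, hX, hPX⟩ := hP x₀
    refine ⟨U, hU, hxU, N, fun a x => c * f a x, X, ?_, hX, ?_⟩
    · exact fun a => contMDiffOn_const.mul (hf a)
    · intro x hx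
      simp only [mul_smul, ← Finset.smul_sum]
      rw [← hPX x hx]
      rfl

end Forms

/-! ## Multisymplectic geometry -/

section Multisymplectic

variable {E : Type*} [NormedAddCommGroup E] [NormedSpace ℝ E] [FiniteDimensional ℝ E]
  {M : Type*} [TopologicalSpace M] [ChartedSpace E M] [IsManifold 𝓘(ℝ, E) ∞ M]

/-- `w` is an `n`-plectic form: a closed `(n + 1)`-form such that `V ↦ V ⌟ w` is injective on every
tangent space. -/
structure IsNPlectic (n : ℕ) (w : DiffForm E M) : Prop where
  degree : w ∈ formsOfDegree E M (n + 1)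
  closed : extD w = 0
  nondegenerate : ∀ (x : M) (v : TangentSpace 𝓘(ℝ, E) x), contractVec (E := E) v (w.1 x) = 0 → v = 0

/-- `X` is a Hamiltonian vector field of the form `α`: `dα = - X ⌟ w`. -/
def IsHamiltonianVField (w α : DiffForm E M) (X : VField E M) : Prop :=
  extD α = -contract X w

/-- The space `Ω^{n-1}_Ham(M)` of Hamiltonian `(n-1)`-forms. -/
def hamiltonianForms (n : ℕ) (w : DiffForm E M) : Submodule ℝ (DiffForm E M) where
  carrier := {α | α ∈ formsOfDegree E M (n - 1) ∧ ∃ X : VField E M, IsHamiltonianVField w α X}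
  zero_mem' := ⟨zero_mem _, 0, by
    have h : contract (0 : VField E M) w = 0 := Subtype.ext <| funext fun x =>
      LinearMap.congr_fun (map_zero (contractVec (E := E))) (w.1 x)
    rw [IsHamiltonianVField, h, map_zero, neg_zero]⟩
  add_mem' := by
    rintro α β ⟨hα, X, hX⟩ ⟨hβ, Y, hY⟩
    have h : contract (X + Y) w = contract X w + contract Y w := Subtype.ext <| funext fun x =>
      LinearMap.congr_fun (map_add (contractVec (E := E)) (X x) (Y x)) (w.1 x)
    refine ⟨add_mem hα hβ, X + Y, ?_⟩
    rw [IsHamiltonianVField] at hX hY ⊢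
    rw [map_add, hX, hY, h, neg_add]
  smul_mem' := by
    rintro c α ⟨hα, X, hX⟩
    have h : contract (c • X) w = c • contract X w := Subtype.ext <| funext fun x =>
      LinearMap.congr_fun (map_smul (contractVec (E := E)) c (X x)) (w.1 x)
    refine ⟨Submodule.smul_mem _ c hα, c • X, ?_⟩
    rw [IsHamiltonianVField] at hX ⊢
    rw [map_smul, hX, h, smul_neg]

/-- The space `Ω^{n-k}_Ham(M)` of Hamiltonian `(n-k)`-forms: the `(n-k)`-forms `α` for which there
is a `k`-vector field `P` with `dα = - P ⌟ w`. -/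
def hamiltonianMultiForms (n : ℕ) (w : DiffForm E M) (k : ℕ) : Submodule ℝ (DiffForm E M) where
  carrier := {α | α ∈ formsOfDegree E M (n - k) ∧ ∃ P ∈ MultiVField E M k,
    ∀ x, (extD α).1 x = -(contractMulti (P x)).unop (w.1 x)}
  zero_mem' := ⟨zero_mem _, 0, zero_mem _, fun x => by simp; rfl⟩
  add_mem' := by
    rintro α β ⟨hα, P, hP, hPα⟩ ⟨hβ, Q, hQ, hQβ⟩
    refine ⟨add_mem hα hβ, P + Q, add_mem hP hQ, fun x => ?_⟩
    rw [map_add, DiffForm.add_val, Pi.add_apply, hPα, hQβ, Pi.add_apply, map_add,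
      MulOpposite.unop_add, LinearMap.add_apply, neg_add]
  smul_mem' := by
    rintro c α ⟨hα, P, hP, hPα⟩
    refine ⟨Submodule.smul_mem _ c hα, c • P, Submodule.smul_mem _ c hP, fun x => ?_⟩
    rw [map_smul, DiffForm.smul_val, Pi.smul_apply, hPα, Pi.smul_apply, map_smul,
      MulOpposite.unop_smul, LinearMap.smul_apply, smul_neg]

open Classical in
/-- The Hamiltonian vector field `X_α` of a Hamiltonian `(n-1)`-form `α` (unique if `w` is
`n`-plectic). -/
def hamVField (w α : DiffForm E M) : VField E M :=
  if h : ∃ X : VField E M, IsHamiltonianVField w α X then h.choose else 0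

/-- The sign `ζ(k) = -(-1)^{k(k+1)/2}`. -/
def zeta (k : ℕ) : ℝ := -(-1) ^ (k * (k + 1) / 2)

/-- The graded vector space of Rogers' Lie `n`-algebra of observables: `L₀ = Ω^{n-1}_Ham(M)`,
`Lᵢ = Ω^{n-1-i}(M)` for `1 ≤ i ≤ n - 1`, and `Lᵢ = 0` otherwise. -/
def observables (n : ℕ) (w : DiffForm E M) (i : ℤ) : Submodule ℝ (DiffForm E M) :=
  if i = 0 then hamiltonianForms n w
  else if 1 ≤ i ∧ i ≤ n - 1 then formsOfDegree E M (n - 1 - i) else ⊥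

/-- The operations `l_k` of the Lie `n`-algebra of observables, extended multilinearly from
homogeneous elements. Since the degree of an `(n-1-i)`-form is `i`, the operation `l₁` is `d` on the
components of form degree `< n - 1`, and is zero on `(n-1)`-forms; for `k ≥ 2`,
`l_k (α₁, …, α_k) = ζ(k) X_{α_k} ⌟ ⋯ ⌟ X_{α₁} ⌟ w` depends on the components of form degree `n - 1`
only, so it is zero if some argument is homogeneous of positive degree. -/
def obsBracket (n : ℕ) (w : DiffForm E M) : (k : ℕ) → (Fin k → DiffForm E M) → DiffForm E M
  | 0, _ => 0
  | 1, α => extD (degreeProj {p | p + 1 < n} (α 0))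
  | k + 2, α => zeta (k + 2) •
      (List.ofFn fun a => hamVField w (degreeProj {p | p + 1 = n} (α a))).foldl
        (fun τ X => contract X τ) w

/-- Places spaces `S k` of `(n-k)`-forms, `1 ≤ k ≤ n`, in degree `i = k - 1`. -/
def regrade (n : ℕ) (S : ℕ → Submodule ℝ (DiffForm E M)) (i : ℤ) : Submodule ℝ (DiffForm E M) :=
  if 0 ≤ i ∧ i ≤ n - 1 then S (i.toNat + 1) else ⊥

/-- The graded vector space `L̂ᵢ = Ω^{n-1-i}_Ham(M)`, `i = 0, …, n - 1`, of Hamiltonian forms. -/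
def hamiltonianObservables (n : ℕ) (w : DiffForm E M) : ℤ → Submodule ℝ (DiffForm E M) :=
  regrade n (hamiltonianMultiForms n w)

/-- The locally conserved Hamiltonian `(n-k)`-forms: `𝓛_X α` is closed. -/
def locallyConserved (n : ℕ) (w : DiffForm E M) (X : VField E M) (k : ℕ) :
    Submodule ℝ (DiffForm E M) :=
  hamiltonianMultiForms n w k ⊓ (LinearMap.ker extD).comap (lieDeriv X)

/-- The globally conserved Hamiltonian `(n-k)`-forms: `𝓛_X α` is exact. -/
def globallyConserved (n : ℕ) (w : DiffForm E M) (X : VField E M) (k : ℕ) :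
    Submodule ℝ (DiffForm E M) :=
  hamiltonianMultiForms n w k ⊓ ((formsOfDegree E M (n - k - 1)).map extD).comap (lieDeriv X)

/-- The strictly conserved Hamiltonian `(n-k)`-forms: `𝓛_X α = 0`. -/
def strictlyConserved (n : ℕ) (w : DiffForm E M) (X : VField E M) (k : ℕ) :
    Submodule ℝ (DiffForm E M) :=
  hamiltonianMultiForms n w k ⊓ LinearMap.ker (lieDeriv X)

end Multisymplectic

end Multisymplectic

end

/-! Everything follows from Cartan calculus applied to `ω` and to vector fields preserving it. The
commutator formula `[𝓛_X, ι_Y] = ι_[X,Y]` (`lieDeriv_contract`), obtained in charts from its flat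
version, gives by induction, for closed `ω` and fields with `𝓛_{X_a} ω = 0`, `d(X_m ⌟ ⋯ ⌟ X_1 ⌟ ω) =
(-1)^m ∑_{a<b} (-1)^{a+b} X_m ⌟ ⋯ ⌟ [X_a, X_b] ⌟ ω`, where the bracket is contracted first and
`X_a`, `X_b` are omitted afterwards (`extD_iterContract`). Hamiltonian fields preserve `ω`, since
`d² = 0`.

For `m = 2` the formula says that the Hamiltonian field of `l_2(α, β)` is `[X_α, X_β]`. An operation
of arity at least `2` sees its arguments only through the Hamiltonian fields of their components of
form degree `n - 1`, and these vanish on exact forms and on the values of `l_k` for `k ≥ 3`. Hence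
for `m ≥ 3` the Jacobi identity has only two contributions, `l_{m-1}(l_2(…), …)` and `l_1(l_m(…))`;
they cancel by the formula and the recursion of the sign `ζ`. The formula also exhibits `d l_m(…)`
as a contraction of `ω` with a multivector field, so the values of the operations are Hamiltonian.

If `𝓛_{X_H} α` is closed, then `[X_H, X_α] ⌟ ω = -d 𝓛_{X_H} α = 0`, so `[X_H, X_α] = 0` by
nondegeneracy. The Leibniz rule then shows that `𝓛_{X_H}` kills every `l_k`, `k ≥ 2`, of locally
conserved forms; for `l_1` it commutes with `d`. All operations thus send locally conserved forms to
strictly conserved ones, which settles the three conservation notions at once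
(`obsBracket_mem_strictlyConserved`). -/

noncomputable section

namespace Multisymplectic

/-! ### Cartan's commutator formula in a vector space -/

section FlatCartan

open ContinuousAlternatingMap VectorField

variable {E : Type*} [NormedAddCommGroup E] [NormedSpace ℝ E] {p : ℕ}

/-- The interior product with a fixed vector, as a continuous linear map on alternating forms. -/
def curryLeftAt (v : E) : E [⋀^Fin (p + 1)]→L[ℝ] ℝ →L[ℝ] E [⋀^Fin p]→L[ℝ] ℝ :=
  ContinuousLinearMap.apply ℝ (E [⋀^Fin p]→L[ℝ] ℝ) v ∘L
    (curryLeftLI (𝕜 := ℝ) (E := E) (F := ℝ) (n := p)).toContinuousLinearMap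

@[simp]
theorem curryLeftAt_apply (v : E) (τ : E [⋀^Fin (p + 1)]→L[ℝ] ℝ) :
    curryLeftAt v τ = τ.curryLeft v := rfl

/-- Polarization of `curryLeft_same` at `v + u`. -/
theorem curryLeft_curryLeft_swap (v u : E) (τ : E [⋀^Fin (p + 2)]→L[ℝ] ℝ) :
    (τ.curryLeft v).curryLeft u = -(τ.curryLeft u).curryLeft v := by
  have h := τ.curryLeft_same (v + u)
  have hv := τ.curryLeft_same v
  have hu := τ.curryLeft_same u
  simp only [map_add, _root_.add_apply, curryLeft_add, hv, hu] at h
  rw [zero_add, add_zero] at h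
  rw [eq_neg_iff_add_eq_zero, ← h]
  abel

theorem curryLeft_sub (τ τ' : E [⋀^Fin (p + 1)]→L[ℝ] ℝ) :
    (τ - τ').curryLeft = τ.curryLeft - τ'.curryLeft :=
  rfl

/-- In the alternating sum, the term of index `0` puts `v` into the slot of `A`; every other term
keeps `v` as first entry of the form, and the index shift by one produces the minus sign. -/
theorem curryLeft_alternatizeUncurryFin (A : E →L[ℝ] E [⋀^Fin (p + 1)]→L[ℝ] ℝ) (v : E) :
    (alternatizeUncurryFin A).curryLeft v =
      A v - alternatizeUncurryFin (curryLeftAt v ∘L A) := by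
  ext u
  rw [curryLeft_apply_apply, alternatizeUncurryFin_apply, Fin.sum_univ_succ,
    ContinuousAlternatingMap.sub_apply, alternatizeUncurryFin_apply, sub_eq_add_neg, ← Finset.sum_neg_distrib]
  congr 1
  · simp
  · refine Finset.sum_congr rfl fun i _ => ?_
    have h : Fin.removeNth i.succ (Matrix.vecCons v u) = Matrix.vecCons v (Fin.removeNth i u) := by
      funext j
      refine Fin.cases ?_ (fun j => ?_) j <;> simp [Fin.removeNth]
    rw [h]
    simp [pow_succ]

theorem curryLeft_alternatizeUncurryFin_zero (A : E →L[ℝ] E [⋀^Fin 0]→L[ℝ] ℝ) (v : E) :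
    (alternatizeUncurryFin A).curryLeft v = A v := by
  ext u
  rw [curryLeft_apply_apply, alternatizeUncurryFin_apply]
  simp

theorem hasFDerivAt_clm_apply_comp {F G : Type*} [NormedAddCommGroup F] [NormedSpace ℝ F]
    [NormedAddCommGroup G] [NormedSpace ℝ G] (C : F →L[ℝ] E →L[ℝ] G) {η : E → F} {V : E → E} {y : E}
    (hη : DifferentiableAt ℝ η y) (hV : DifferentiableAt ℝ V y) :
    HasFDerivAt (fun z => C (η z) (V z))
      (ContinuousLinearMap.apply ℝ G (V y) ∘L C ∘L fderiv ℝ η y + C (η y) ∘L fderiv ℝ V y) y := by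
  refine ((C.hasFDerivAt.comp y hη.hasFDerivAt).clm_apply hV.hasFDerivAt).congr_fderiv ?_
  ext v : 1
  exact add_comm _ _

theorem hasFDerivAt_curryLeft {η : E → E [⋀^Fin (p + 1)]→L[ℝ] ℝ} {V : E → E} {y : E}
    (hη : DifferentiableAt ℝ η y) (hV : DifferentiableAt ℝ V y) :
    HasFDerivAt (fun z => (η z).curryLeft (V z))
      (curryLeftAt (V y) ∘L fderiv ℝ η y + (η y).curryLeft ∘L fderiv ℝ V y) y :=
  hasFDerivAt_clm_apply_comp
    (curryLeftLI (𝕜 := ℝ) (E := E) (F := ℝ) (n := p)).toContinuousLinearMap hη hV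

theorem extDeriv_curryLeft {η : E → E [⋀^Fin (p + 1)]→L[ℝ] ℝ} {V : E → E} {y : E}
    (hη : DifferentiableAt ℝ η y) (hV : DifferentiableAt ℝ V y) :
    extDeriv (fun z => (η z).curryLeft (V z)) y =
      alternatizeUncurryFin (curryLeftAt (V y) ∘L fderiv ℝ η y) +
        alternatizeUncurryFin ((η y).curryLeft ∘L fderiv ℝ V y) := by
  rw [extDeriv, (hasFDerivAt_curryLeft hη hV).fderiv, alternatizeUncurryFin_add]

/-- The formula `[𝓛_V, ι_W] = ι_[V, W]` in a vector space, on forms of positive degree. -/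
theorem cartan_commutator_flat {η : E → E [⋀^Fin (p + 2)]→L[ℝ] ℝ} {V W : E → E} {y : E}
    (hη : DifferentiableAt ℝ η y) (hV : DifferentiableAt ℝ V y) (hW : DifferentiableAt ℝ W y) :
    extDeriv (fun z => ((η z).curryLeft (W z)).curryLeft (V z)) y +
        (extDeriv (fun z => (η z).curryLeft (W z)) y).curryLeft (V y) -
        ((extDeriv (fun z => (η z).curryLeft (V z)) y).curryLeft (W y) +
          ((extDeriv η y).curryLeft (V y)).curryLeft (W y)) =
      (η y).curryLeft (lieBracket ℝ V W y) := by
  have hWη := hasFDerivAt_curryLeft hη hW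
  rw [extDeriv_curryLeft hWη.differentiableAt hV, hWη.fderiv, extDeriv_curryLeft hη hW,
    extDeriv_curryLeft hη hV, extDeriv, ContinuousLinearMap.comp_add, alternatizeUncurryFin_add]
  simp only [curryLeft_add, _root_.add_apply, curryLeft_alternatizeUncurryFin,
    curryLeft_sub, _root_.sub_apply, ContinuousLinearMap.comp_apply,
    curryLeftAt_apply, lieBracket, map_sub]
  -- The cross term containing `DV` arises once from `d(ι_V ι_W η)` and once from `ι_W d(ι_V η)`,
  -- with the two contractions in opposite order; anticommutation makes them cancel.
  have h1 : ((η y).curryLeft (W y)).curryLeft ∘L fderiv ℝ V y =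
      -(curryLeftAt (W y) ∘L (η y).curryLeft ∘L fderiv ℝ V y) := by
    ext v : 1
    exact curryLeft_curryLeft_swap _ _ _
  have h2 : ∀ A : E →L[ℝ] E [⋀^Fin (p + 1)]→L[ℝ] ℝ,
      alternatizeUncurryFin (-(curryLeftAt (W y) ∘L A)) =
        -alternatizeUncurryFin (curryLeftAt (W y) ∘L A) := fun A =>
    map_neg (alternatizeUncurryFinCLM ℝ E ℝ) _
  rw [h1, h2]
  abel

/-- The formula `[𝓛_V, ι_W] = ι_[V, W]` in a vector space, on `1`-forms. -/
theorem cartan_commutator_flat_zero {η : E → E [⋀^Fin 1]→L[ℝ] ℝ} {V W : E → E} {y : E}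
    (hη : DifferentiableAt ℝ η y) (hV : DifferentiableAt ℝ V y) (hW : DifferentiableAt ℝ W y) :
    (extDeriv (fun z => (η z).curryLeft (W z)) y).curryLeft (V y) -
        ((extDeriv (fun z => (η z).curryLeft (V z)) y).curryLeft (W y) +
          ((extDeriv η y).curryLeft (V y)).curryLeft (W y)) =
      (η y).curryLeft (lieBracket ℝ V W y) := by
  rw [extDeriv_curryLeft hη hW, extDeriv_curryLeft hη hV, extDeriv]
  simp only [curryLeft_add, _root_.add_apply, curryLeft_alternatizeUncurryFin,
    curryLeft_alternatizeUncurryFin_zero,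
    curryLeft_sub, _root_.sub_apply, ContinuousLinearMap.comp_apply,
    curryLeftAt_apply, lieBracket, map_sub]
  abel

end FlatCartan

/-! ### Cartan calculus on the manifold -/

section ManifoldCartan

open VectorField

variable {E : Type*} [NormedAddCommGroup E] [NormedSpace ℝ E]
  {M : Type*} [TopologicalSpace M] [ChartedSpace E M]

theorem DiffForm.ext {η θ : DiffForm E M} (h : ∀ x p, η.1 x p = θ.1 x p) : η = θ :=
  Subtype.ext (funext fun x => funext fun p => h x p)

theorem DiffForm.differentiableAt_chartRep (η : DiffForm E M) (x : M) (p : ℕ) :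
    DifferentiableAt ℝ (chartRep x p η.1) (extChartAt 𝓘(ℝ, E) x x) :=
  ((η.2 x p).contDiffAt ((isOpen_extChartAt_target x).mem_nhds
    (mem_extChartAt_target x))).differentiableAt (by simp)

variable [IsManifold 𝓘(ℝ, E) ∞ M]

/-- A vector field written in the chart at `x₀`. -/
def chartVField (x₀ : M) (X : (x : M) → TangentSpace 𝓘(ℝ, E) x) (y : E) : E :=
  mpullbackWithin 𝓘(ℝ, E) 𝓘(ℝ, E) (extChartAt 𝓘(ℝ, E) x₀).symm X (Set.range 𝓘(ℝ, E)) y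

theorem mfderiv_chartVField (x₀ : M) (X : (x : M) → TangentSpace 𝓘(ℝ, E) x) {y : E}
    (hy : y ∈ (extChartAt 𝓘(ℝ, E) x₀).target) :
    (mfderiv 𝓘(ℝ, E) 𝓘(ℝ, E) (extChartAt 𝓘(ℝ, E) x₀).symm y : E → E) (chartVField (E := E) x₀ X y) =
      X ((extChartAt 𝓘(ℝ, E) x₀).symm y) := by
  have : IsManifold 𝓘(ℝ, E) 1 M := IsManifold.of_le (n := ∞) (by exact_mod_cast le_top)
  have hinv := isInvertible_mfderivWithin_extChartAt_symm (I := 𝓘(ℝ, E)) hy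
  have := hinv.self_apply_inverse (X ((extChartAt 𝓘(ℝ, E) x₀).symm y))
  simp only [modelWithCornersSelf_coe, Set.range_id, mfderivWithin_univ] at this
  simp only [chartVField, mpullbackWithin, modelWithCornersSelf_coe, Set.range_id,
    mfderivWithin_univ]
  exact this

theorem chartRep_contractVec (x₀ : M) (X : (x : M) → TangentSpace 𝓘(ℝ, E) x) (η : RoughForm E M)
    (p : ℕ) {y : E} (hy : y ∈ (extChartAt 𝓘(ℝ, E) x₀).target) :
    chartRep x₀ p (fun x => contractVec (E := E) (X x) (η x)) y =
      (chartRep x₀ (p + 1) η y).curryLeft (chartVField x₀ X y) := by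
  have h0 := mfderiv_chartVField x₀ X hy
  unfold chartRep
  erw [ContinuousAlternatingMap.curryLeft_compContinuousLinearMap]
  erw [h0]
  rfl

/-- The derivative of the inverse chart is invertible, so pulling back loses nothing. Identities of
forms may therefore be checked at the centre of each chart. -/
theorem eq_of_chartRep_eq {x : M} {p : ℕ} {η θ : RoughForm E M}
    (h : chartRep x p η (extChartAt 𝓘(ℝ, E) x x) = chartRep x p θ (extChartAt 𝓘(ℝ, E) x x)) :
    η x p = θ x p := by
  have : IsManifold 𝓘(ℝ, E) 1 M := IsManifold.of_le (n := ∞) (by exact_mod_cast le_top)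
  have hinv := isInvertible_mfderivWithin_extChartAt_symm (I := 𝓘(ℝ, E))
    (mem_extChartAt_target (I := 𝓘(ℝ, E)) x)
  simp only [modelWithCornersSelf_coe, Set.range_id, mfderivWithin_univ] at hinv
  -- The chart followed by its inverse returns `x` only up to a propositional equality; a free point
  -- `z` allows it to be substituted.
  have key : ∀ z : M, z = x → chartRep x p η (extChartAt 𝓘(ℝ, E) x x) =
      chartRep x p θ (extChartAt 𝓘(ℝ, E) x x) →
      (extChartAt 𝓘(ℝ, E) x).symm (extChartAt 𝓘(ℝ, E) x x) = z → η z p = θ z p := by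
    rintro z - h rfl
    ext v
    have h2 := congrArg (fun τ : E [⋀^Fin p]→L[ℝ] ℝ => τ fun i =>
      (mfderiv 𝓘(ℝ, E) 𝓘(ℝ, E) (extChartAt 𝓘(ℝ, E) x).symm
        (extChartAt 𝓘(ℝ, E) x x)).inverse (v i)) h
    have h3 : ∀ i, mfderiv 𝓘(ℝ, E) 𝓘(ℝ, E) (extChartAt 𝓘(ℝ, E) x).symm
        (extChartAt 𝓘(ℝ, E) x x) ((mfderiv 𝓘(ℝ, E) 𝓘(ℝ, E) (extChartAt 𝓘(ℝ, E) x).symm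
        (extChartAt 𝓘(ℝ, E) x x)).inverse (v i)) = v i := fun i => hinv.self_apply_inverse (v i)
    have h4 : ∀ ζ : RoughForm E M, chartRep x p ζ (extChartAt 𝓘(ℝ, E) x x) (fun i =>
      (mfderiv 𝓘(ℝ, E) 𝓘(ℝ, E) (extChartAt 𝓘(ℝ, E) x).symm
        (extChartAt 𝓘(ℝ, E) x x)).inverse (v i)) =
        ζ ((extChartAt 𝓘(ℝ, E) x).symm (extChartAt 𝓘(ℝ, E) x x)) p v := fun ζ =>
      congrArg (ζ ((extChartAt 𝓘(ℝ, E) x).symm (extChartAt 𝓘(ℝ, E) x x)) p) (funext h3)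
    exact (h4 η).symm.trans (h2.trans (h4 θ))
  exact key x rfl h (extChartAt_to_inv x)

theorem chartRep_extD (η : DiffForm E M) (x : M) (p : ℕ) {y : E}
    (hy : y ∈ (extChartAt 𝓘(ℝ, E) x).target) :
    chartRep x (p + 1) (extD η).1 y = extDeriv (chartRep x p η.1) y :=
  chartRep_roughExtDeriv η.2 x p hy

theorem chartRep_extD_zero (η : DiffForm E M) (x : M) (y : E) : chartRep x 0 (extD η).1 y = 0 :=
  rfl

theorem extD_extD (η : DiffForm E M) : extD (extD η) = 0 := by
  refine DiffForm.ext fun x p => eq_of_chartRep_eq ?_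
  have hx := mem_extChartAt_target (I := 𝓘(ℝ, E)) x
  have hnh := (isOpen_extChartAt_target (I := 𝓘(ℝ, E)) x).mem_nhds hx
  have h0 : ∀ q y, chartRep x q (0 : DiffForm E M).1 y = 0 := fun q y => rfl
  rw [h0]
  rcases p with _ | _ | p
  · rfl
  · rw [chartRep_extD _ _ _ hx]
    have : chartRep x 0 (extD η).1 = fun _ => 0 := funext fun y => chartRep_extD_zero η x y
    rw [this]
    simp only [extDeriv, fderiv_fun_const]
    exact map_zero (ContinuousAlternatingMap.alternatizeUncurryFinCLM ℝ E ℝ)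
  · rw [chartRep_extD _ _ _ hx, Filter.EventuallyEq.extDeriv_eq
      (Filter.eventually_of_mem hnh fun y hy => chartRep_extD η x p hy)]
    exact extDeriv_extDeriv_apply ((η.2 x p).contDiffAt hnh)
      (by simpa using (WithTop.coe_le_coe.2 le_top : ((2 : ℕ∞) : WithTop ℕ∞) ≤ ∞))

variable [FiniteDimensional ℝ E]

theorem contDiffOn_chartVField (x₀ : M) (X : VField E M) :
    ContDiffOn ℝ ∞ (chartVField x₀ X) (extChartAt 𝓘(ℝ, E) x₀).target := by
  have : CompleteSpace E := FiniteDimensional.complete ℝ E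
  intro y hy
  have h := ContMDiffWithinAt.mpullbackWithin_vectorField_inter (I := 𝓘(ℝ, E)) (I' := 𝓘(ℝ, E))
    (f := (extChartAt 𝓘(ℝ, E) x₀).symm) (s := Set.range 𝓘(ℝ, E)) (t := Set.univ) (x₀ := y)
    (m := ∞) (n := ∞) (V := fun x => X x) (X.contMDiff _).contMDiffWithinAt
    (((contMDiffOn_extChartAt_symm (I := 𝓘(ℝ, E)) (n := ∞) x₀).contMDiffAt
      ((isOpen_extChartAt_target x₀).mem_nhds hy)).contMDiffWithinAt)
    (isInvertible_mfderivWithin_extChartAt_symm hy) (by simp) (by simpa using uniqueMDiffOn_univ)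
    (by simp)
  have h2 := (contMDiffWithinAt_vectorSpace_iff_contDiffWithinAt (V := chartVField x₀ X)).1 h
  exact h2.mono (by simp)

/-- The Lie bracket of smooth vector fields. -/
def lie (X Y : VField E M) : VField E M :=
  ⟨fun x => mlieBracket 𝓘(ℝ, E) (fun x => X x) (fun x => Y x) x, by
    have : CompleteSpace E := FiniteDimensional.complete ℝ E
    have : IsManifold 𝓘(ℝ, E) (minSmoothness ℝ 3) M := by
      have h3 : (3 : WithTop ℕ∞) ≤ ∞ :=
        (WithTop.coe_le_coe.2 le_top : ((3 : ℕ∞) : WithTop ℕ∞) ≤ ∞)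
      simpa using IsManifold.of_le (n := ∞) h3
    have : IsManifold 𝓘(ℝ, E) ((((⊤ : ℕ∞) : WithTop ℕ∞)) + 1) M := by simpa
    intro x
    exact ContMDiffAt.mlieBracket_vectorField (n := ⊤) (m := ⊤) (X.contMDiff x) (Y.contMDiff x)
      (by simp)⟩

/-- `mlieBracket` is defined as the pullback by the chart of the bracket of the fields in
coordinates; the invertible derivative of the chart is cancelled from both sides. -/
theorem chartVField_lie (x : M) (X Y : VField E M) :
    chartVField x (fun z => lie X Y z) (extChartAt 𝓘(ℝ, E) x x) =
      lieBracket ℝ (chartVField x fun z => X z) (chartVField x fun z => Y z)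
        (extChartAt 𝓘(ℝ, E) x x) := by
  have : IsManifold 𝓘(ℝ, E) 1 M := IsManifold.of_le (n := ∞) (by exact_mod_cast le_top)
  have h1 := (eventuallyEq_mpullback_mpullbackWithin_extChartAt (I := 𝓘(ℝ, E)) (s := Set.univ)
    (x := x) fun z => lie X Y z).eq_of_nhdsWithin (Set.mem_univ x)
  have h2 : lie X Y x = mlieBracketWithin 𝓘(ℝ, E) (fun x => X x) (fun x => Y x) Set.univ x := rfl
  rw [h2, mlieBracketWithin_apply, mpullback_apply] at h1
  have h3 := (isInvertible_mfderiv_extChartAt (I := 𝓘(ℝ, E))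
    (mem_extChartAt_source (I := 𝓘(ℝ, E)) x)).inverse.injective h1
  have hs : (extChartAt 𝓘(ℝ, E) x).symm ⁻¹' Set.univ ∩ Set.range 𝓘(ℝ, E) = Set.univ := by simp
  rw [hs] at h3
  change lieBracketWithin ℝ (chartVField x fun z => X z) (chartVField x fun z => Y z) Set.univ _ =
    chartVField x (fun z => lie X Y z) _ at h3
  rw [← h3, lieBracketWithin_univ]

theorem chartRep_contract (X : VField E M) (η : DiffForm E M) (x : M) (p : ℕ) {y : E}
    (hy : y ∈ (extChartAt 𝓘(ℝ, E) x).target) :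
    chartRep x p (contract X η).1 y =
      (chartRep x (p + 1) η.1 y).curryLeft (chartVField x X y) :=
  chartRep_contractVec x (fun x => X x) η.1 p hy

/-- Each side is evaluated at the centre of a chart, where the flat formula applies. Component `0`
is separate: there the term `d(ι_X ι_Y η)` is absent because `d` has no component of degree `0`. -/
theorem lieDeriv_contract (X Y : VField E M) (η : DiffForm E M) :
    lieDeriv X (contract Y η) = contract Y (lieDeriv X η) + contract (lie X Y) η := by
  refine DiffForm.ext fun x p => eq_of_chartRep_eq ?_
  have hx := mem_extChartAt_target (I := 𝓘(ℝ, E)) x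
  have hnh := (isOpen_extChartAt_target (I := 𝓘(ℝ, E)) x).mem_nhds hx
  have hV : ∀ Z : VField E M, DifferentiableAt ℝ (chartVField x Z) (extChartAt 𝓘(ℝ, E) x x) :=
    fun Z => ((contDiffOn_chartVField x Z).contDiffAt hnh).differentiableAt (by simp)
  have hc : ∀ (Z : VField E M) (ζ : DiffForm E M) (q : ℕ),
      extDeriv (chartRep x q (contract Z ζ).1) (extChartAt 𝓘(ℝ, E) x x) =
        extDeriv (fun y => (chartRep x (q + 1) ζ.1 y).curryLeft (chartVField x Z y))
          (extChartAt 𝓘(ℝ, E) x x) := fun Z ζ q =>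
    Filter.EventuallyEq.extDeriv_eq
      (Filter.eventually_of_mem hnh fun y hy => chartRep_contract Z ζ x q hy)
  have hadd : ∀ (ζ θ : DiffForm E M) (q : ℕ) (y : E),
      chartRep x q (ζ + θ).1 y = chartRep x q ζ.1 y + chartRep x q θ.1 y := fun ζ θ q y => rfl
  have hL : ∀ (Z : VField E M) (ζ : DiffForm E M),
      lieDeriv Z ζ = extD (contract Z ζ) + contract Z (extD ζ) := fun Z ζ => rfl
  rw [hadd, ← sub_eq_iff_eq_add', chartRep_contract _ _ _ _ hx, chartRep_contract _ _ _ _ hx,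
    chartVField_lie, hL, hL, hadd, hadd]
  simp only [chartRep_contract _ _ _ _ hx, chartRep_extD _ _ _ hx, hc]
  cases p with
  | zero =>
    rw [chartRep_extD_zero, zero_add]
    rw [← cartan_commutator_flat_zero (η.differentiableAt_chartRep x 1) (hV X) (hV Y)]
    rfl
  | succ p =>
    rw [chartRep_extD _ _ _ hx, hc]
    rw [← cartan_commutator_flat (η.differentiableAt_chartRep x (p + 2)) (hV X) (hV Y)]
    congr 2
    refine Filter.EventuallyEq.extDeriv_eq (Filter.eventually_of_mem hnh fun y hy => ?_)
    exact congrArg (fun τ : E [⋀^Fin (p + 1)]→L[ℝ] ℝ => τ.curryLeft (chartVField x X y))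
      (chartRep_contract Y η x (p + 1) hy)

end ManifoldCartan

/-! ### Iterated interior products and their exterior derivative -/

section IteratedContraction

variable {E : Type*} [NormedAddCommGroup E] [NormedSpace ℝ E]

theorem contractMulti_ιMulti_zero (v : Fin 0 → E) :
    (contractMulti (ExteriorAlgebra.ιMulti ℝ 0 v)).unop = 1 := by
  rw [ExteriorAlgebra.ιMulti_zero_apply, map_one, MulOpposite.unop_one]

theorem contractMulti_ιMulti_succ {k : ℕ} (v : Fin (k + 1) → E) :
    (contractMulti (ExteriorAlgebra.ιMulti ℝ (k + 1) v)).unop =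
      (contractMulti (ExteriorAlgebra.ιMulti ℝ k (Fin.tail v))).unop * contractVec (v 0) := by
  rw [ExteriorAlgebra.ιMulti_succ_apply, map_mul, MulOpposite.unop_mul]
  congr 1
  rw [contractMulti, ExteriorAlgebra.lift_ι_apply]
  rfl

variable [FiniteDimensional ℝ E]
  {M : Type*} [TopologicalSpace M] [ChartedSpace E M] [IsManifold 𝓘(ℝ, E) ∞ M]

/-- The iterated interior product `X_k ⌟ ⋯ ⌟ X_1 ⌟ τ`. -/
def iterContract {k : ℕ} (X : Fin k → VField E M) (τ : DiffForm E M) : DiffForm E M :=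
  (List.ofFn X).foldl (fun τ X => contract X τ) τ

@[simp]
theorem iterContract_zero (X : Fin 0 → VField E M) (τ : DiffForm E M) :
    iterContract X τ = τ := by
  simp [iterContract]

@[simp]
theorem iterContract_cons {k : ℕ} (X : VField E M) (Y : Fin k → VField E M) (τ : DiffForm E M) :
    iterContract (Fin.cons X Y : Fin (k + 1) → VField E M) τ = iterContract Y (contract X τ) := by
  simp [iterContract, List.ofFn_succ]

@[simp]
theorem iterContract_snoc {k : ℕ} (Y : Fin k → VField E M) (Z : VField E M) (τ : DiffForm E M) :
    iterContract (Fin.snoc Y Z : Fin (k + 1) → VField E M) τ = contract Z (iterContract Y τ) := by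
  rw [iterContract, iterContract, List.ofFn_succ', List.concat_eq_append, List.foldl_append]
  simp

theorem iterContract_add {k : ℕ} (X : Fin k → VField E M) (τ τ' : DiffForm E M) :
    iterContract X (τ + τ') = iterContract X τ + iterContract X τ' := by
  induction k generalizing τ τ' with
  | zero => simp
  | succ k ih =>
    rw [← Fin.cons_self_tail X]
    simp only [iterContract_cons, map_add, ih]

theorem iterContract_form_zero {k : ℕ} (X : Fin k → VField E M) :
    iterContract X (0 : DiffForm E M) = 0 := by
  have h := iterContract_add X 0 0
  rwa [add_zero, left_eq_add] at h

/-- The iterated interior product as an additive map in the form. -/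
def iterContractHom {k : ℕ} (X : Fin k → VField E M) : DiffForm E M →+ DiffForm E M :=
  AddMonoidHom.mk' (iterContract X) (iterContract_add X)

/-- The value of a vector field at a point. -/
def evalAt (x : M) : VField E M →ₗ[ℝ] E where
  toFun X := X x
  map_add' _ _ := rfl
  map_smul' _ _ := rfl

theorem contract_val (X : VField E M) (τ : DiffForm E M) (x : M) :
    (contract X τ).1 x = contractVec (evalAt x X) (τ.1 x) := rfl

theorem iterContract_val {k : ℕ} (X : Fin k → VField E M) (τ : DiffForm E M) (x : M) :
    (iterContract X τ).1 x =
      (contractMulti (ExteriorAlgebra.ιMulti ℝ k fun i => evalAt x (X i))).unop (τ.1 x) := by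
  induction k generalizing τ with
  | zero => rw [iterContract_zero, contractMulti_ιMulti_zero]; rfl
  | succ k ih =>
    obtain ⟨y, Y, rfl⟩ : ∃ y Y', X = Fin.cons y Y' := ⟨_, _, (Fin.cons_self_tail X).symm⟩
    rw [iterContract_cons, ih, contractMulti_ιMulti_succ, contract_val]
    rfl

/-- The iterated interior product is multilinear and alternating in the vector fields. -/
def iterContractAlt (k : ℕ) (τ : DiffForm E M) : VField E M [⋀^Fin k]→ₗ[ℝ] DiffForm E M where
  toFun X := iterContract X τ
  map_update_add' := by
    intro _ X i Y Z
    refine Subtype.ext (funext fun x => ?_)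
    -- All three axioms are inherited pointwise from `ExteriorAlgebra.ιMulti`, through the linear
    -- map `contractMulti`.
    have h := ((ExteriorAlgebra.ιMulti ℝ k (M := E)).compLinearMap (evalAt x)).map_update_add
      X i Y Z
    have h2 := congrArg (fun P => (contractMulti P).unop (τ.1 x)) h
    rw [DiffForm.add_val, Pi.add_apply, iterContract_val, iterContract_val, iterContract_val]
    refine .trans ?_ (h2.trans ?_)
    · congr!
    · simp only [map_add, MulOpposite.unop_add, LinearMap.add_apply]
      rfl
  map_update_smul' := by
    intro _ X i c Y
    refine Subtype.ext (funext fun x => ?_)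
    have h := ((ExteriorAlgebra.ιMulti ℝ k (M := E)).compLinearMap (evalAt x)).map_update_smul
      X i c Y
    have h2 := congrArg (fun P => (contractMulti P).unop (τ.1 x)) h
    rw [DiffForm.smul_val, Pi.smul_apply, iterContract_val, iterContract_val]
    refine .trans ?_ (h2.trans ?_)
    · congr!
    · simp only [map_smul, MulOpposite.unop_smul, LinearMap.smul_apply]
      rfl
  map_eq_zero_of_eq' := by
    intro X i j hij hne
    refine Subtype.ext (funext fun x => ?_)
    have h := ((ExteriorAlgebra.ιMulti ℝ k (M := E)).compLinearMap (evalAt x)).map_eq_zero_of_eq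
      X hij hne
    have h2 := congrArg (fun P => (contractMulti P).unop (τ.1 x)) h
    rw [iterContract_val]
    refine h2.trans ?_
    simp only [map_zero, MulOpposite.unop_zero, LinearMap.zero_apply]
    rfl

theorem iterContractAlt_apply {k : ℕ} (X : Fin k → VField E M) (τ : DiffForm E M) :
    iterContractAlt k τ X = iterContract X τ := rfl

theorem iterContract_perm {k : ℕ} (X : Fin k → VField E M) (τ : DiffForm E M)
    (σ : Equiv.Perm (Fin k)) :
    iterContract (fun i => X (σ i)) τ = Equiv.Perm.sign σ • iterContract X τ :=
  (iterContractAlt k τ).map_perm X σ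

theorem iterContract_of_eq_zero {k : ℕ} {X : Fin k → VField E M} (τ : DiffForm E M) {i : Fin k}
    (h : X i = 0) : iterContract X τ = 0 :=
  (iterContractAlt k τ).map_coord_zero i h

/-- Bringing the letter at position `i` to the front is a cycle of sign `(-1)^i`. -/
theorem iterContract_insertNth {k : ℕ} (i : Fin (k + 1)) (Z : VField E M) (Y : Fin k → VField E M)
    (τ : DiffForm E M) : iterContract (i.insertNth Z Y : Fin (k + 1) → VField E M) τ =
      ((-1 : ℤˣ) ^ (i : ℕ)) • iterContract (Fin.cons Z Y : Fin (k + 1) → VField E M) τ := by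
  rw [← Fin.insertNth_comp_cycleRange_symm i Z Y]
  have := iterContract_perm (i.insertNth Z Y : Fin (k + 1) → VField E M) τ i.cycleRange.symm
  rw [Equiv.Perm.sign_symm, Fin.sign_cycleRange] at this
  change _ = _ • iterContract (fun j => (i.insertNth Z Y : Fin (k + 1) → VField E M)
    (i.cycleRange.symm j)) τ
  rw [this, smul_smul, ← pow_add, Even.neg_one_pow ⟨_, rfl⟩, one_smul]

theorem contract_zero_left (τ : DiffForm E M) : contract (0 : VField E M) τ = 0 :=
  Subtype.ext <| funext fun x => LinearMap.congr_fun (map_zero (contractVec (E := E))) (τ.1 x)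

theorem contract_neg_left (X : VField E M) (τ : DiffForm E M) :
    contract (-X) τ = -contract X τ :=
  Subtype.ext <| funext fun x =>
    LinearMap.congr_fun (map_neg (contractVec (E := E)) (X x)) (τ.1 x)

theorem lie_swap (X Y : VField E M) : lie X Y = -lie Y X := by
  ext x
  exact VectorField.mlieBracket_swap_apply

/-- The Leibniz rule: `𝓛_Z` is moved past one contraction at a time by `lieDeriv_contract`. -/
theorem lieDeriv_iterContract {k : ℕ} (Z : VField E M) (Y : Fin k → VField E M)
    (τ : DiffForm E M) :
    lieDeriv Z (iterContract Y τ) = iterContract Y (lieDeriv Z τ) +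
      ∑ i, iterContract (Function.update Y i (lie Z (Y i))) τ := by
  induction k generalizing τ with
  | zero => simp
  | succ k ih =>
    obtain ⟨y, Y, rfl⟩ : ∃ y Y', Y = Fin.cons y Y' := ⟨_, _, (Fin.cons_self_tail Y).symm⟩
    rw [iterContract_cons, ih, Fin.sum_univ_succ, lieDeriv_contract, iterContract_add]
    simp only [iterContract_cons, Fin.cons_zero, Fin.cons_succ, Fin.update_cons_zero,
      ← Fin.cons_update]
    abel

/-- The `(i, j)`-term of the exterior derivative of an iterated interior product. -/
def bracketTerm {k : ℕ} (X : Fin (k + 2) → VField E M) (τ : DiffForm E M) (i : Fin (k + 2))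
    (j : Fin (k + 1)) : DiffForm E M :=
  iterContract (Fin.cons (lie (X i) (X (i.succAbove j))) (j.removeNth (i.removeNth X)) :
    Fin (k + 1) → VField E M) τ

/-- Induction step of the main formula: `d ι_Z = 𝓛_Z - ι_Z d` for the outermost field `Z`, with
`𝓛_Z` expanded by the Leibniz rule. The sum gives the pairs containing `Z`, the subtracted term
those avoiding it. -/
theorem extD_iterContract_snoc {k : ℕ} (Y : Fin (k + 1) → VField E M) (Z : VField E M)
    {τ : DiffForm E M} (hZ : lieDeriv Z τ = 0) :
    extD (iterContract (Fin.snoc Y Z : Fin (k + 2) → VField E M) τ) =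
      ∑ i : Fin (k + 1), ((-1 : ℤˣ) ^ (i : ℕ)) •
        iterContract (Fin.cons (lie Z (Y i)) (i.removeNth Y) : Fin (k + 1) → VField E M) τ -
      contract Z (extD (iterContract Y τ)) := by
  have h : extD (contract Z (iterContract Y τ)) =
      lieDeriv Z (iterContract Y τ) - contract Z (extD (iterContract Y τ)) :=
    (add_sub_cancel_right _ _).symm
  rw [iterContract_snoc, h, lieDeriv_iterContract, hZ, iterContract_form_zero, zero_add]
  congr 1
  refine Finset.sum_congr rfl fun i _ => ?_
  rw [← iterContract_insertNth, Fin.insertNth_removeNth]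

theorem bracketTerm_snoc_castSucc {k : ℕ} (Y : Fin (k + 2) → VField E M) (Z : VField E M)
    (τ : DiffForm E M) (i : Fin (k + 2)) (j : Fin (k + 1)) :
    bracketTerm (Fin.snoc Y Z : Fin (k + 3) → VField E M) τ i.castSucc j.castSucc =
      contract Z (bracketTerm Y τ i j) := by
  rw [bracketTerm, bracketTerm, ← iterContract_snoc, ← Fin.cons_snoc_eq_snoc_cons]
  congr 2
  · rw [Fin.castSucc_succAbove_castSucc, Fin.snoc_castSucc, Fin.snoc_castSucc]
  · funext a
    refine Fin.lastCases ?_ (fun a => ?_) a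
    · simp [Fin.removeNth]
    · simp only [Fin.removeNth, Fin.castSucc_succAbove_castSucc, Fin.snoc_castSucc]

theorem bracketTerm_snoc_last {k : ℕ} (Y : Fin (k + 1) → VField E M) (Z : VField E M)
    (τ : DiffForm E M) (i : Fin (k + 1)) :
    bracketTerm (Fin.snoc Y Z : Fin (k + 2) → VField E M) τ i.castSucc (Fin.last k) =
      -iterContract (Fin.cons (lie Z (Y i)) (i.removeNth Y) : Fin (k + 1) → VField E M) τ := by
  have hlast : i.castSucc.succAbove (Fin.last k) = Fin.last (k + 1) := by
    rw [Fin.succAbove_castSucc_of_le _ _ (Fin.le_last i), Fin.succ_last]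
  rw [bracketTerm, iterContract_cons, iterContract_cons, hlast,
    Fin.snoc_castSucc, Fin.snoc_last, lie_swap, contract_neg_left]
  have h : (Fin.last k).removeNth (i.castSucc.removeNth (Fin.snoc Y Z : Fin (k + 2) → VField E M)) =
      i.removeNth Y := by
    funext a
    simp only [Fin.removeNth, Fin.succAbove_last, Fin.castSucc_succAbove_castSucc,
      Fin.snoc_castSucc]
  rw [h]
  exact map_neg (iterContractHom _) _

/-- The exterior derivative of the iterated interior product of a closed form with vector fields
that preserve it. -/
theorem extD_iterContract {k : ℕ} (X : Fin (k + 2) → VField E M) {τ : DiffForm E M}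
    (hτ : extD τ = 0) (hX : ∀ i, lieDeriv (X i) τ = 0) :
    extD (iterContract X τ) = ∑ i : Fin (k + 2), ∑ j : Fin (k + 1),
      if i ≤ j.castSucc then ((-1 : ℤˣ) ^ (k + i + j + 1)) • bracketTerm X τ i j else 0 := by
  -- Induction on the number of fields, removing the outermost one. The condition `i ≤ j.castSucc`
  -- means `i < i.succAbove j`, so each pair of letters is counted once.
  induction k with
  | zero =>
    obtain ⟨Y, Z, rfl⟩ : ∃ (Y : Fin 1 → VField E M) (Z : VField E M), X = Fin.snoc Y Z :=
      ⟨_, _, (Fin.snoc_init_self X).symm⟩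
    have hZ : lieDeriv Z τ = 0 := hX (Fin.last 1)
    have hY : extD (iterContract Y τ) = 0 := by
      have h1 : lieDeriv (Y 0) τ = 0 := by simpa [Fin.snoc] using hX 0
      have h2 : lieDeriv (Y 0) τ = extD (contract (Y 0) τ) + contract (Y 0) (extD τ) := rfl
      rw [h2, hτ, map_zero, add_zero] at h1
      rw [← h1, ← Fin.cons_self_tail Y, iterContract_cons]
      simp
    rw [extD_iterContract_snoc Y Z hZ, hY]
    simp only [Fin.sum_univ_castSucc (n := 1), Fin.sum_univ_one, map_zero, sub_zero]
    have h : bracketTerm (Fin.snoc Y Z : Fin 2 → VField E M) τ 0 0 = _ :=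
      bracketTerm_snoc_last Y Z τ 0
    simp [h]
  | succ k ih =>
    obtain ⟨Y, Z, rfl⟩ : ∃ (Y : Fin (k + 2) → VField E M) (Z : VField E M), X = Fin.snoc Y Z :=
      ⟨_, _, (Fin.snoc_init_self X).symm⟩
    have hZ : lieDeriv Z τ = 0 := by simpa using hX (Fin.last _)
    have hlast : ∀ j : Fin (k + 2), ¬ Fin.last (k + 2) ≤ j.castSucc := fun j =>
      not_le.2 (Fin.castSucc_lt_last j)
    rw [extD_iterContract_snoc Y Z hZ, ih Y fun i => by simpa using hX i.castSucc,
      Fin.sum_univ_castSucc (n := k + 2)]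
    simp only [hlast, if_false, Finset.sum_const_zero, add_zero, map_sum]
    rw [← Finset.sum_sub_distrib]
    refine Finset.sum_congr rfl fun i _ => ?_
    rw [Fin.sum_univ_castSucc (n := k + 1), bracketTerm_snoc_last, if_pos
      (Fin.castSucc_le_castSucc_iff.2 (Fin.le_last i)), sub_eq_neg_add, ← Finset.sum_neg_distrib]
    congr 1
    · refine Finset.sum_congr rfl fun j _ => ?_
      rw [bracketTerm_snoc_castSucc]
      simp only [Fin.castSucc_le_castSucc_iff, Fin.val_castSucc]
      split_ifs
      · have h : k + 1 + (i : ℕ) + j + 1 = (k + i + j + 1) + 1 := by ring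
        rw [h, pow_succ _ (k + i + j + 1), Units.smul_def, Units.smul_def, map_zsmul]
        simp
      · simp
    · have h : (-1 : ℤˣ) ^ (k + 1 + (i.castSucc : ℕ) + (Fin.last (k + 1) : ℕ) + 1) =
          -(-1) ^ (i : ℕ) := by
        have h' : k + 1 + (i.castSucc : ℕ) + (Fin.last (k + 1) : ℕ) + 1 = 2 * (k + 1) + 1 + i := by
          simp; ring
        rw [h', pow_add, pow_add, pow_mul]
        simp
      rw [h, smul_neg, Units.smul_def, Units.smul_def, Units.val_neg, neg_smul, neg_neg]

end IteratedContraction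

/-! ### `(2, k)`-unshuffles as pairs of letters -/

section Unshuffles

/-- The permutation that lists `i`, then `i.succAbove j`, then all other letters in increasing
order. -/
def pairPerm {k : ℕ} (i : Fin (k + 2)) (j : Fin (k + 1)) : Equiv.Perm (Fin (k + 2)) :=
  i.cycleRange.symm * Equiv.Perm.decomposeFin.symm (0, j.cycleRange.symm)

variable {k : ℕ} (i : Fin (k + 2)) (j : Fin (k + 1))

theorem pairPerm_zero : pairPerm i j 0 = i := by
  simp [pairPerm]

theorem pairPerm_one : pairPerm i j 1 = i.succAbove j := by
  rw [← Fin.succ_zero_eq_one', pairPerm, Equiv.Perm.mul_apply,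
    Equiv.Perm.decomposeFin_symm_apply_succ]
  simp

theorem pairPerm_succ_succ (b : Fin k) :
    pairPerm i j b.succ.succ = i.succAbove (j.succAbove b) := by
  rw [pairPerm, Equiv.Perm.mul_apply, Equiv.Perm.decomposeFin_symm_apply_succ]
  simp

theorem sign_pairPerm : Equiv.Perm.sign (pairPerm i j) = (-1) ^ ((i : ℕ) + j) := by
  rw [pairPerm, Equiv.Perm.sign_mul, Equiv.Perm.decomposeFin.symm_sign, Equiv.Perm.sign_symm,
    Equiv.Perm.sign_symm, Fin.sign_cycleRange, Fin.sign_cycleRange, pow_add]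
  simp

variable {i j} in
theorem isUnshuffle_pairPerm (h : i ≤ j.castSucc) : IsUnshuffle 2 (pairPerm i j) := by
  intro a b hab h2
  refine Fin.cases (fun hab h2 => ?_) (fun a => Fin.cases (fun hab h2 => ?_) (fun a hab h2 => ?_) a)
    a hab h2
  · have hb : b = 1 := by
      rw [Fin.lt_def] at hab
      simp at hab h2
      ext
      simp
      omega
    rw [hb, pairPerm_zero, pairPerm_one]
    exact Fin.lt_succAbove_iff_le_castSucc i j |>.2 h
  · rw [Fin.lt_def] at hab
    simp at hab h2
    omega
  · obtain ⟨b, rfl⟩ : ∃ b' : Fin k, b = b'.succ.succ := by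
      rw [Fin.lt_def] at hab
      simp at hab
      exact ⟨⟨b - 2, by omega⟩, by ext; simp; omega⟩
    rw [pairPerm_succ_succ, pairPerm_succ_succ]
    exact Fin.strictMono_succAbove i (Fin.strictMono_succAbove j (by simpa using hab))

theorem range_perm_succ_succ (σ : Equiv.Perm (Fin (k + 2))) :
    Set.range (fun b : Fin k => σ b.succ.succ) = {σ 0, σ 1}ᶜ := by
  have h1 : (0 : Fin (k + 1)).succ = 1 := rfl
  ext y
  obtain ⟨x, rfl⟩ := σ.surjective y
  simp only [Set.mem_range, EmbeddingLike.apply_eq_iff_eq, Set.mem_compl_iff,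
    Set.mem_insert_iff, Set.mem_singleton_iff]
  refine Fin.cases ?_ (fun x => Fin.cases ?_ (fun x => ?_) x) x
  · simp
  · rw [h1]
    have h2 : ∀ b : Fin k, b.succ.succ ≠ 1 := fun b h => Fin.succ_ne_zero b (Fin.succ_injective _ h)
    simp [h2]
  · have h2 : x.succ.succ ≠ 1 := fun h => Fin.succ_ne_zero x (Fin.succ_injective _ h)
    simp [h2]

-- After its first two values, a `(2, k)`-unshuffle enumerates the remaining letters increasingly,
-- and an increasing enumeration is determined by its range.
variable {i j} in
theorem IsUnshuffle.eq_pairPerm {σ : Equiv.Perm (Fin (k + 2))} (hσ : IsUnshuffle 2 σ)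
    (h0 : σ 0 = i) (h1 : σ 1 = i.succAbove j) (h : i ≤ j.castSucc) : σ = pairPerm i j := by
  have hmono : ∀ τ : Equiv.Perm (Fin (k + 2)), IsUnshuffle 2 τ →
      StrictMono (fun b : Fin k => τ b.succ.succ) := fun τ hτ a b hab =>
    hτ _ _ (by simpa using hab) (Or.inr (by simp))
  have key := (StrictMono.range_inj (hmono σ hσ) (hmono _ (isUnshuffle_pairPerm h))).1 (by
    rw [range_perm_succ_succ, range_perm_succ_succ, pairPerm_zero, pairPerm_one, h0, h1])
  ext1 x
  refine Fin.cases ?_ (fun x => Fin.cases ?_ (fun x => ?_) x) x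
  · rw [h0, pairPerm_zero]
  · rw [Fin.succ_zero_eq_one', h1, pairPerm_one]
  · exact congrFun key x

open Classical in
/-- Summing over `(2, k)`-unshuffles amounts to summing over pairs of letters. -/
theorem sum_isUnshuffle_two {A : Type*} [AddCommMonoid A] (g : Equiv.Perm (Fin (k + 2)) → A) :
    ∑ σ : Equiv.Perm (Fin (k + 2)) with IsUnshuffle 2 σ, g σ =
      ∑ i : Fin (k + 2), ∑ j : Fin (k + 1),
        if i ≤ j.castSucc then g (pairPerm i j) else 0 := by
  rw [← Finset.sum_product', ← Finset.sum_filter]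
  symm
  refine Finset.sum_bij (fun q _ => pairPerm q.1 q.2) ?_ ?_ ?_ ?_
  · rintro ⟨i, j⟩ h
    simpa using isUnshuffle_pairPerm (by simpa using h)
  · rintro ⟨i, j⟩ h ⟨i', j'⟩ h' heq
    have h0 : i = i' := by simpa only [pairPerm_zero] using congrArg (fun σ => σ 0) heq
    subst h0
    have h1 : i.succAbove j = i.succAbove j' := by
      simpa only [pairPerm_one] using congrArg (fun σ => σ 1) heq
    rw [Fin.succAbove_right_injective h1]
  · intro σ hσ
    have hσ : IsUnshuffle 2 σ := by simpa using hσ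
    obtain ⟨j, hj⟩ := Fin.exists_succAbove_eq (x := σ 1) (y := σ 0) (by simp)
    have hlt : σ 0 < σ 1 := hσ 0 1 (by simp) (Or.inl (by simp))
    have hle : σ 0 ≤ j.castSucc := by
      rw [← hj] at hlt
      exact Fin.lt_succAbove_iff_le_castSucc _ _ |>.1 hlt
    exact ⟨(σ 0, j), by simpa using hle, (hσ.eq_pairPerm rfl hj.symm hle).symm⟩
  · intro q _
    rfl

theorem isUnshuffle_self_iff {m : ℕ} (σ : Equiv.Perm (Fin m)) : IsUnshuffle m σ ↔ σ = 1 := by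
  constructor
  · intro h
    have hm : StrictMono σ := fun a b hab => h a b hab (Or.inl b.2)
    have := (StrictMono.range_inj hm strictMono_id).1 (by simp)
    ext1 x
    exact congrFun this x
  · rintro rfl a b hab _
    exact hab

theorem koszulSign_one {m : ℕ} (d : Fin m → ℤ) : koszulSign d 1 = 1 := by
  rw [koszulSign, Finset.filter_false_of_mem, Finset.prod_empty]
  intro q _ h
  exact lt_asymm h.1 h.2

theorem koszulSign_of_forall_eq_zero {m : ℕ} {d : Fin m → ℤ} (hd : ∀ a, d a = 0)
    (σ : Equiv.Perm (Fin m)) : koszulSign d σ = 1 := by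
  refine Finset.prod_eq_one fun q _ => ?_
  rw [hd, zero_mul, Int.negOnePow_zero]

end Unshuffles

/-! ### Restriction to graded subspaces -/

section Restriction

variable {V : Type*} [AddCommGroup V] [Module ℝ V]

/-- A graded subspace closed under the operations of an L∞-algebra is an L∞-algebra. -/
theorem IsLInftyAlgebra.restrict {W L : ℤ → Submodule ℝ V} {l : (k : ℕ) → (Fin k → V) → V}
    (hL : IsLInftyAlgebra L l) (hle : ∀ i, W i ≤ L i) (hW : IsClosedUnder W l) :
    IsLInftyAlgebra W l where
  independent := hL.independent.mono hle
  degree := hW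
  multilinear k hk x hx a y hy z hz c :=
    hL.multilinear k hk x (fun b => iSup_mono hle (hx b)) a y (iSup_mono hle hy) z
      (iSup_mono hle hz) c
  skew k hk d x hx := hL.skew k hk d x fun a => hle _ (hx a)
  jacobi m hm d x hx := hL.jacobi m hm d x fun a => hle _ (hx a)

end Restriction

/-! ### Form degrees and projections -/

section Degrees

variable {E : Type*} [NormedAddCommGroup E] [NormedSpace ℝ E]
  {M : Type*} [TopologicalSpace M] [ChartedSpace E M]

theorem degreeProj_val_of_mem {S : Set ℕ} {p : ℕ} (hp : p ∈ S) (η : DiffForm E M) (x : M) :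
    (degreeProj S η).1 x p = η.1 x p := if_pos hp

theorem degreeProj_val_of_notMem {S : Set ℕ} {p : ℕ} (hp : p ∉ S) (η : DiffForm E M) (x : M) :
    (degreeProj S η).1 x p = 0 := if_neg hp

theorem degreeProj_eq_self {S : Set ℕ} {j : ℤ} {η : DiffForm E M} (hη : η ∈ formsOfDegree E M j)
    (h : ∀ p : ℕ, (p : ℤ) = j → p ∈ S) : degreeProj S η = η := by
  refine DiffForm.ext fun x p => ?_
  by_cases hp : p ∈ S
  · exact degreeProj_val_of_mem hp η x
  · rw [degreeProj_val_of_notMem hp, hη x p fun hj => hp (h p hj)]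

theorem degreeProj_eq_zero {S : Set ℕ} {j : ℤ} {η : DiffForm E M} (hη : η ∈ formsOfDegree E M j)
    (h : ∀ p : ℕ, (p : ℤ) = j → p ∉ S) : degreeProj S η = 0 := by
  refine DiffForm.ext fun x p => ?_
  by_cases hp : p ∈ S
  · rw [degreeProj_val_of_mem hp, hη x p fun hj => h p hj hp]
    rfl
  · exact degreeProj_val_of_notMem hp η x

theorem eq_zero_of_mem_formsOfDegree {j : ℤ} (hj : j < 0) {η : DiffForm E M}
    (hη : η ∈ formsOfDegree E M j) : η = 0 :=
  DiffForm.ext fun x p => hη x p (by omega)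

theorem iSupIndep_formsOfDegree : iSupIndep (formsOfDegree E M) := by
  intro j
  rw [Submodule.disjoint_def]
  intro η hη hη'
  -- `K` consists of the forms without component of degree `j`; it contains all the other
  -- homogeneous pieces.
  let K : Submodule ℝ (DiffForm E M) :=
    { carrier := {η | ∀ (x : M) (p : ℕ), (p : ℤ) = j → η.1 x p = 0}
      zero_mem' := fun _ _ _ => rfl
      add_mem' := fun {η θ} hη hθ x p hp => by
        change η.1 x p + θ.1 x p = 0
        rw [hη x p hp, hθ x p hp, add_zero]
      smul_mem' := fun c η hη x p hp => by
        change c • η.1 x p = 0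
        rw [hη x p hp, smul_zero] }
  have hK : ⨆ i, ⨆ (_ : i ≠ j), formsOfDegree E M i ≤ K :=
    iSup₂_le fun i hi θ hθ x p hp => hθ x p fun h => hi (h.symm.trans hp)
  refine DiffForm.ext fun x p => ?_
  by_cases hp : (p : ℤ) = j
  · exact hK hη' x p hp
  · exact hη x p hp

variable [IsManifold 𝓘(ℝ, E) ∞ M]

theorem extD_val_eq_zero {η : DiffForm E M} {p : ℕ} (h : ∀ x, η.1 x p = 0) (x : M) :
    (extD η).1 x (p + 1) = 0 := by
  have h0 : chartRep x p η.1 = chartRep x p (0 : DiffForm E M).1 := by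
    funext y
    rw [chartRep, h]
    rfl
  have h1 : (extD η).1 x (p + 1) = (extD (0 : DiffForm E M)).1 x (p + 1) := by
    change (extDeriv (chartRep x p η.1) _).compContinuousLinearMap _ =
      (extDeriv (chartRep x p (0 : DiffForm E M).1) _).compContinuousLinearMap _
    rw [h0]
  rw [h1, map_zero]
  rfl

theorem extD_mem_formsOfDegree {j : ℤ} {η : DiffForm E M} (hη : η ∈ formsOfDegree E M j) :
    extD η ∈ formsOfDegree E M (j + 1) := by
  rintro x (_ | p) hp
  · rfl
  · exact extD_val_eq_zero (fun y => hη y p fun h => hp (by push_cast; omega)) x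

/-- Since `d` raises degree by one, a homogeneous component of an exact form is again exact. This
makes Hamiltonian fields of exact forms vanish even for inhomogeneous forms. -/
theorem degreeProj_extD (S : Set ℕ) (η : DiffForm E M) :
    degreeProj S (extD η) = extD (degreeProj {p | p + 1 ∈ S} η) := by
  have hsub : ∀ θ : DiffForm E M, ∀ x q, (η - θ).1 x q = η.1 x q - θ.1 x q := fun _ _ _ => rfl
  refine DiffForm.ext fun x p => ?_
  rcases p with _ | p
  · by_cases hp : 0 ∈ S
    · rw [degreeProj_val_of_mem hp]; rfl
    · rw [degreeProj_val_of_notMem hp]; rfl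
  · by_cases hp : p + 1 ∈ S
    · rw [degreeProj_val_of_mem hp, ← sub_eq_zero]
      have h := extD_val_eq_zero (η := η - degreeProj {p | p + 1 ∈ S} η) (p := p) (fun y => by
        rw [hsub, degreeProj_val_of_mem (S := {p | p + 1 ∈ S}) hp, sub_self]) x
      rw [map_sub] at h
      exact h
    · rw [degreeProj_val_of_notMem hp]
      exact (extD_val_eq_zero (fun y =>
        degreeProj_val_of_notMem (S := {p | p + 1 ∈ S}) hp η y) x).symm

variable [FiniteDimensional ℝ E]

theorem contract_mem_formsOfDegree {j : ℤ} (X : VField E M) {η : DiffForm E M}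
    (hη : η ∈ formsOfDegree E M j) : contract X η ∈ formsOfDegree E M (j - 1) := by
  intro x p hp
  change (η.1 x (p + 1)).curryLeft (X x) = 0
  rw [hη x (p + 1) (by push_cast; omega)]
  rfl

theorem iterContract_mem_formsOfDegree {k : ℕ} {j : ℤ} (X : Fin k → VField E M)
    {η : DiffForm E M} (hη : η ∈ formsOfDegree E M j) :
    iterContract X η ∈ formsOfDegree E M (j - k) := by
  induction k generalizing j η with
  | zero => simpa using hη
  | succ k ih =>
    obtain ⟨y, Y, rfl⟩ : ∃ y Y', X = Fin.cons y Y' := ⟨_, _, (Fin.cons_self_tail X).symm⟩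
    rw [iterContract_cons]
    have := ih Y (contract_mem_formsOfDegree y hη)
    rwa [sub_sub, add_comm (1 : ℤ), ← Nat.cast_succ] at this

theorem extD_lieDeriv (X : VField E M) (η : DiffForm E M) :
    extD (lieDeriv X η) = lieDeriv X (extD η) := by
  change extD (extD (contract X η) + contract X (extD η)) =
    extD (contract X (extD η)) + contract X (extD (extD η))
  rw [map_add, extD_extD, extD_extD, map_zero, zero_add, add_zero]

end Degrees

/-! ### Multivector fields and contractions of `ω` -/

section MultivectorFields

variable {E : Type*} [NormedAddCommGroup E] [NormedSpace ℝ E]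

theorem ιMulti_one (v : Fin 1 → E) :
    ExteriorAlgebra.ιMulti ℝ 1 v = ExteriorAlgebra.ι ℝ (v 0) := by
  rw [ExteriorAlgebra.ιMulti_succ_apply, ExteriorAlgebra.ιMulti_zero_apply, mul_one]

variable {M : Type*} [TopologicalSpace M] [ChartedSpace E M] [IsManifold 𝓘(ℝ, E) ∞ M]

/-- Locally `P` is `ι` of the smooth field `∑ f_a X_a`. The global left inverse
`ExteriorAlgebra.ιInv` recovers one vector at each point, so the local fields agree without any
gluing. -/
theorem exists_vField_of_mem_multiVField_one {P : M → ExteriorAlgebra ℝ E}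
    (hP : P ∈ MultiVField E M 1) :
    ∃ X : VField E M, ∀ x, P x = ExteriorAlgebra.ι ℝ (evalAt x X) := by
  have hloc : ∀ x₀ : M, ∃ U : Set M, IsOpen U ∧ x₀ ∈ U ∧
      ∃ Y : (x : M) → TangentSpace 𝓘(ℝ, E) x,
        ContMDiffOn 𝓘(ℝ, E) 𝓘(ℝ, E).tangent ∞
          (fun x => (⟨x, Y x⟩ : TangentBundle 𝓘(ℝ, E) M)) U ∧
        ∀ x ∈ U, P x = ExteriorAlgebra.ι ℝ (M := E) (Y x) := by
    intro x₀
    obtain ⟨U, hU, hx, N, f, X, hf, hX, hPX⟩ := hP x₀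
    refine ⟨U, hU, hx, fun x => ∑ a, f a x • X a 0 x, ?_, fun x hxU => ?_⟩
    · exact ContMDiffOn.sum_section fun a _ => (hf a).smul_section (hX a 0)
    · rw [hPX x hxU]
      refine .trans ?_ (map_sum (ExteriorAlgebra.ι ℝ (M := E)) _ _).symm
      refine Finset.sum_congr rfl fun a _ => ?_
      refine .trans ?_ (map_smul (ExteriorAlgebra.ι ℝ (M := E)) _ _).symm
      exact congrArg (f a x • ·) (ιMulti_one _)
  have hι := ExteriorAlgebra.ι_leftInverse (R := ℝ) (M := E)
  refine ⟨⟨fun x => (ExteriorAlgebra.ιInv (R := ℝ) (M := E) (P x) : E), fun x₀ => ?_⟩, fun x => ?_⟩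
  · obtain ⟨U, hU, hx, Y, hY, hPY⟩ := hloc x₀
    refine (hY.contMDiffAt (hU.mem_nhds hx)).congr_of_eventuallyEq
      (Filter.eventually_of_mem (hU.mem_nhds hx) fun x hxU => ?_)
    exact congrArg (fun v : E => (⟨x, v⟩ : TangentBundle 𝓘(ℝ, E) M))
      ((congrArg ExteriorAlgebra.ιInv (hPY x hxU)).trans (hι (Y x)))
  · obtain ⟨U, hU, hx, Y, hY, hPY⟩ := hloc x
    change P x = ExteriorAlgebra.ι ℝ (ExteriorAlgebra.ιInv (P x))
    rw [hPY x hx]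
    exact congrArg (ExteriorAlgebra.ι ℝ) (hι (Y x)).symm

theorem ιMulti_mem_multiVField {k : ℕ} (X : Fin k → VField E M) :
    (fun x => ExteriorAlgebra.ιMulti ℝ k fun i => evalAt x (X i)) ∈ MultiVField E M k :=
  fun _ => ⟨Set.univ, isOpen_univ, trivial, 1, fun _ _ => 1, fun _ i x => X i x,
    fun _ => contMDiffOn_const, fun _ i => (X i).contMDiff.contMDiffOn, fun x _ => by
      rw [Fin.sum_univ_one, one_smul]; rfl⟩

/-- The contractions of a form with smooth `k`-vector fields. -/
def multiContractions (w : DiffForm E M) (k : ℕ) : Submodule ℝ (DiffForm E M) where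
  carrier := {η | ∃ P ∈ MultiVField E M k, ∀ x, η.1 x = -(contractMulti (P x)).unop (w.1 x)}
  zero_mem' := ⟨0, zero_mem _, fun x => by simp; rfl⟩
  add_mem' := by
    rintro α β ⟨P, hP, hPα⟩ ⟨Q, hQ, hQβ⟩
    refine ⟨P + Q, add_mem hP hQ, fun x => ?_⟩
    rw [DiffForm.add_val, Pi.add_apply, hPα, hQβ, Pi.add_apply, map_add,
      MulOpposite.unop_add, LinearMap.add_apply, neg_add]
  smul_mem' := by
    rintro c α ⟨P, hP, hPα⟩
    refine ⟨c • P, Submodule.smul_mem _ c hP, fun x => ?_⟩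
    rw [DiffForm.smul_val, Pi.smul_apply, hPα, Pi.smul_apply, map_smul,
      MulOpposite.unop_smul, LinearMap.smul_apply, smul_neg]

theorem mem_hamiltonianMultiForms {n : ℕ} {w : DiffForm E M} {k : ℕ} {α : DiffForm E M} :
    α ∈ hamiltonianMultiForms n w k ↔
      α ∈ formsOfDegree E M (n - k) ∧ extD α ∈ multiContractions w k := Iff.rfl

variable [FiniteDimensional ℝ E]

theorem iterContract_mem_multiContractions {k : ℕ} (X : Fin k → VField E M) (w : DiffForm E M) :
    iterContract X w ∈ multiContractions w k := by
  rw [← neg_mem_iff]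
  refine ⟨_, ιMulti_mem_multiVField X, fun x => ?_⟩
  rw [← iterContract_val]
  rfl

theorem hamiltonianMultiForms_one_le (n : ℕ) (w : DiffForm E M) :
    hamiltonianMultiForms n w 1 ≤ hamiltonianForms n w := by
  rintro α ⟨hα, P, hP, hPα⟩
  obtain ⟨X, hX⟩ := exists_vField_of_mem_multiVField_one hP
  refine ⟨by simpa using hα, X, Subtype.ext (funext fun x => ?_)⟩
  rw [hPα, hX, contractMulti, ExteriorAlgebra.lift_ι_apply]
  rfl

end MultivectorFields

/-! ### The sign `ζ` -/

section Signs

theorem neg_one_pow_units_smul {V : Type*} [AddCommGroup V] [Module ℝ V] (e : ℕ) (v : V) :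
    ((-1 : ℤˣ) ^ e) • v = ((-1 : ℝ) ^ e) • v := by
  rcases Nat.even_or_odd e with h | h
  · rw [h.neg_one_pow, h.neg_one_pow, one_smul, one_smul]
  · rw [h.neg_one_pow, h.neg_one_pow, Units.smul_def]
    simp

theorem zeta_succ (k : ℕ) : zeta (k + 1) = (-1) ^ (k + 1) * zeta k := by
  have h : (k + 1) * (k + 1 + 1) / 2 = k * (k + 1) / 2 + (k + 1) := by
    rw [show (k + 1) * (k + 1 + 1) = k * (k + 1) + 2 * (k + 1) by ring,
      Nat.add_mul_div_left _ _ (by norm_num)]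
  rw [zeta, zeta, h, pow_add]
  ring

theorem zeta_two : zeta 2 = 1 := by
  norm_num [zeta]

end Signs

/-! ### Hamiltonian vector fields and the operations -/

section Observables

variable {E : Type*} [NormedAddCommGroup E] [NormedSpace ℝ E] [FiniteDimensional ℝ E]
  {M : Type*} [TopologicalSpace M] [ChartedSpace E M] [IsManifold 𝓘(ℝ, E) ∞ M]
  {n : ℕ} {w : DiffForm E M}

variable (n w) in
/-- The Hamiltonian vector field of the component of form degree `n - 1`. -/
def obsField (α : DiffForm E M) : VField E M :=
  hamVField w (degreeProj {p | p + 1 = n} α)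

theorem obsBracket_one (α : Fin 1 → DiffForm E M) :
    obsBracket n w 1 α = extD (degreeProj {p | p + 1 < n} (α 0)) := rfl

theorem obsBracket_add_two {k : ℕ} (α : Fin (k + 2) → DiffForm E M) :
    obsBracket n w (k + 2) α = zeta (k + 2) • iterContract (fun a => obsField n w (α a)) w := rfl

theorem obsBracket_eq_of_eq_one {k : ℕ} (hk : k = 1) (α : Fin k → DiffForm E M) :
    obsBracket n w k α = extD (degreeProj {p | p + 1 < n} (α ⟨0, by omega⟩)) := by
  subst hk
  rfl

theorem obsBracket_eq_zero {k : ℕ} (hk : 2 ≤ k) (α : Fin k → DiffForm E M) (a : Fin k)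
    (h : obsField n w (α a) = 0) : obsBracket n w k α = 0 := by
  obtain ⟨k, rfl⟩ := Nat.exists_eq_add_of_le' hk
  rw [obsBracket_add_two, iterContract_of_eq_zero w (i := a) h, smul_zero]

namespace IsNPlectic

theorem eq_zero_of_contract_eq_zero (hw : IsNPlectic n w)
    {X : VField E M} (h : contract X w = 0) : X = 0 := by
  ext x
  exact hw.nondegenerate x (X x) (congrFun (congrArg Subtype.val h) x)

theorem hamVField_eq (hw : IsNPlectic n w)
    {α : DiffForm E M} {X : VField E M} (h : IsHamiltonianVField w α X) :
    hamVField w α = X := by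
  have hex : ∃ X : VField E M, IsHamiltonianVField w α X := ⟨X, h⟩
  have hY : IsHamiltonianVField w α (hamVField w α) := by
    rw [hamVField, dif_pos hex]
    exact hex.choose_spec
  rw [← sub_eq_zero]
  apply hw.eq_zero_of_contract_eq_zero
  have h1 : contract (hamVField w α) w = contract X w := by
    rw [IsHamiltonianVField] at h hY
    exact neg_injective (hY.symm.trans h)
  have h2 : contract (hamVField w α - X) w = contract (hamVField w α) w - contract X w :=
    Subtype.ext <| funext fun x => LinearMap.congr_fun
      (map_sub (contractVec (E := E)) (evalAt x (hamVField w α)) (evalAt x X)) (w.1 x)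
  rw [h2, h1, sub_self]

theorem hamVField_eq_zero (hw : IsNPlectic n w)
    {α : DiffForm E M} (h : extD α = 0) : hamVField w α = 0 :=
  hw.hamVField_eq (by rw [IsHamiltonianVField, h, contract_zero_left, neg_zero])

theorem lieDeriv_of_isHamiltonianVField (hw : IsNPlectic n w) {α : DiffForm E M} {X : VField E M}
    (h : IsHamiltonianVField w α X) : lieDeriv X w = 0 := by
  change extD (contract X w) + contract X (extD w) = 0
  rw [IsHamiltonianVField] at h
  rw [hw.closed, map_zero, add_zero, ← neg_neg (contract X w), ← h, map_neg, extD_extD, neg_zero]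

theorem lieDeriv_hamVField (hw : IsNPlectic n w)
    (α : DiffForm E M) : lieDeriv (hamVField w α) w = 0 := by
  by_cases hex : ∃ X : VField E M, IsHamiltonianVField w α X
  · obtain ⟨X, hX⟩ := hex
    rw [hw.hamVField_eq hX]
    exact hw.lieDeriv_of_isHamiltonianVField hX
  -- Without a Hamiltonian field the default value is `0`, which also preserves `ω`; so no
  -- hypothesis on `α` is needed.
  · rw [hamVField, dif_neg hex]
    change extD (contract 0 w) + contract 0 (extD w) = 0
    rw [contract_zero_left, contract_zero_left, map_zero, add_zero]

theorem obsField_eq_zero_of_mem (hw : IsNPlectic n w)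
    {j : ℤ} {α : DiffForm E M} (hα : α ∈ formsOfDegree E M j)
    (hj : j ≠ n - 1) : obsField n w α = 0 := by
  rw [obsField, degreeProj_eq_zero hα fun p hp h => hj (by
    have : p + 1 = n := h
    omega)]
  exact hw.hamVField_eq_zero (map_zero _)

theorem obsField_eq (hw : IsNPlectic n w)
    {α : DiffForm E M} {X : VField E M} (hα : α ∈ formsOfDegree E M (n - 1))
    (h : IsHamiltonianVField w α X) : obsField n w α = X := by
  rw [obsField, degreeProj_eq_self (S := {p | p + 1 = n}) hα fun p hp => (by omega : p + 1 = n)]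
  exact hw.hamVField_eq h

theorem isHamiltonianVField_obsField (hw : IsNPlectic n w)
    {α : DiffForm E M} (hα : α ∈ hamiltonianForms n w) :
    IsHamiltonianVField w α (obsField n w α) := by
  obtain ⟨h1, X, hX⟩ := hα
  rwa [hw.obsField_eq h1 hX]

theorem obsField_extD (hw : IsNPlectic n w) (α : DiffForm E M) : obsField n w (extD α) = 0 := by
  rw [obsField, degreeProj_extD]
  exact hw.hamVField_eq_zero (extD_extD _)

theorem obsField_zero (hw : IsNPlectic n w) : obsField n w 0 = 0 := by
  rw [← map_zero extD]
  exact hw.obsField_extD 0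

theorem lieDeriv_obsField (hw : IsNPlectic n w)
    (α : DiffForm E M) : lieDeriv (obsField n w α) w = 0 :=
  hw.lieDeriv_hamVField _

theorem obsBracket_mem_formsOfDegree (hw : IsNPlectic n w)
    {k : ℕ} (hk : 2 ≤ k) (α : Fin k → DiffForm E M) :
    obsBracket n w k α ∈ formsOfDegree E M (n + 1 - k) := by
  obtain ⟨k, rfl⟩ := Nat.exists_eq_add_of_le' hk
  exact Submodule.smul_mem _ _ (iterContract_mem_formsOfDegree _ hw.degree)

/-- For two fields the derivative formula reads `d(X_2 ⌟ X_1 ⌟ ω) = -[X_1, X_2] ⌟ ω`, and `ζ(2) =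
1`. -/
theorem obsField_obsBracket_two (hw : IsNPlectic n w) (α : Fin 2 → DiffForm E M) :
    obsField n w (obsBracket n w 2 α) = lie (obsField n w (α 0)) (obsField n w (α 1)) := by
  refine hw.obsField_eq ?_ ?_
  · have := hw.obsBracket_mem_formsOfDegree le_rfl α
    rwa [show (n : ℤ) + 1 - (2 : ℕ) = n - 1 by push_cast; ring] at this
  · rw [IsHamiltonianVField, obsBracket_add_two, zeta_two, one_smul,
      extD_iterContract _ hw.closed fun i => hw.lieDeriv_obsField _]
    simp [bracketTerm]

/-- The value has form degree `n + 1 - k < n - 1`. -/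
theorem obsField_obsBracket_of_three_le (hw : IsNPlectic n w)
    {k : ℕ} (hk : 3 ≤ k) (α : Fin k → DiffForm E M) :
    obsField n w (obsBracket n w k α) = 0 :=
  hw.obsField_eq_zero_of_mem (hw.obsBracket_mem_formsOfDegree (by omega) α) (by omega)

theorem obsField_obsBracket_one (hw : IsNPlectic n w) (α : Fin 1 → DiffForm E M) :
    obsField n w (obsBracket n w 1 α) = 0 :=
  hw.obsField_extD _

theorem extD_obsBracket (hw : IsNPlectic n w) {k : ℕ} (α : Fin (k + 2) → DiffForm E M) :
    extD (obsBracket n w (k + 2) α) = zeta (k + 2) • ∑ i : Fin (k + 2), ∑ j : Fin (k + 1),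
      if i ≤ j.castSucc then ((-1 : ℤˣ) ^ (k + i + j + 1)) •
        bracketTerm (fun a => obsField n w (α a)) w i j else 0 := by
  rw [obsBracket_add_two, map_smul, extD_iterContract _ hw.closed fun i => hw.lieDeriv_obsField _]

/-- Each term of the derivative formula contracts `ω` with `k + 1` fields, one of them a bracket, as
required of a Hamiltonian form in degree `k`. Beyond degree `n - 1` the form degree is negative and
the value is zero. -/
theorem obsBracket_mem_regrade (hw : IsNPlectic n w) {k : ℕ} (α : Fin (k + 2) → DiffForm E M) :
    obsBracket n w (k + 2) α ∈ regrade n (hamiltonianMultiForms n w) k := by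
  have hdeg := hw.obsBracket_mem_formsOfDegree (by omega) α
  rw [regrade]
  split_ifs with h
  · rw [mem_hamiltonianMultiForms]
    constructor
    · convert hdeg using 2
      push_cast
      simp
      ring
    · rw [hw.extD_obsBracket]
      refine Submodule.smul_mem _ _ (Submodule.sum_mem _ fun i _ =>
        Submodule.sum_mem _ fun j _ => ?_)
      split_ifs
      · rw [neg_one_pow_units_smul]
        exact Submodule.smul_mem _ _ (iterContract_mem_multiContractions _ w)
      · exact zero_mem _
  · rw [Submodule.mem_bot]
    exact eq_zero_of_mem_formsOfDegree (by push_cast; omega) hdeg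

end IsNPlectic

end Observables

/-! ### The generalized Jacobi identity -/

section Jacobi

variable {E : Type*} [NormedAddCommGroup E] [NormedSpace ℝ E] [FiniteDimensional ℝ E]
  {M : Type*} [TopologicalSpace M] [ChartedSpace E M] [IsManifold 𝓘(ℝ, E) ∞ M]
  {n : ℕ} {w : DiffForm E M}

theorem observables_le (i : ℤ) : observables n w i ≤ formsOfDegree E M (n - 1 - i) := by
  rw [observables]
  split_ifs with h0 h
  · rw [h0, sub_zero]
    exact fun α hα => hα.1
  · exact le_rfl
  · exact bot_le

namespace IsNPlectic

theorem obsField_eq_zero_of_mem_observables (hw : IsNPlectic n w) {i : ℤ} (hi : i ≠ 0)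
    {α : DiffForm E M} (hα : α ∈ observables n w i) : obsField n w α = 0 :=
  hw.obsField_eq_zero_of_mem (observables_le i hα) (by omega)

/-- The terms of the generalized Jacobi identity with an inner operation of arity different from
`2` and `m` vanish. -/
theorem obsBracket_cons_eq_zero (hw : IsNPlectic n w) {r s : ℕ} (hr : 1 ≤ r) (hr2 : r ≠ 2)
    (hs : 1 ≤ s) (α : Fin r → DiffForm E M) (β : Fin s → DiffForm E M) :
    obsBracket n w (s + 1) (Fin.cons (obsBracket n w r α) β) = 0 := by
  refine obsBracket_eq_zero (by omega) _ 0 ?_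
  rw [Fin.cons_zero]
  rcases Nat.lt_or_ge r 3 with h | h
  · obtain rfl : r = 1 := by omega
    exact hw.obsField_obsBracket_one α
  · exact hw.obsField_obsBracket_of_three_le h α

/-- The generalized Jacobi identity in terms of the Hamiltonian vector fields. -/
theorem sum_bracketTerm_add_extD (hw : IsNPlectic n w) {k : ℕ}
    (α : Fin (k + 3) → DiffForm E M) :
    (∑ i : Fin (k + 3), ∑ j : Fin (k + 2), if i ≤ j.castSucc then
      ((-1 : ℤˣ) ^ ((i : ℕ) + j)) • zeta (k + 2) • bracketTerm (fun a => obsField n w (α a)) w i j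
      else 0) + extD (obsBracket n w (k + 3) α) = 0 := by
  rw [hw.extD_obsBracket (k := k + 1), Finset.smul_sum, ← Finset.sum_add_distrib]
  refine Finset.sum_eq_zero fun i _ => ?_
  rw [Finset.smul_sum, ← Finset.sum_add_distrib]
  refine Finset.sum_eq_zero fun j _ => ?_
  split_ifs
  · rw [neg_one_pow_units_smul, neg_one_pow_units_smul, smul_smul, smul_smul, ← add_smul,
      zeta_succ (k + 2)]
    -- The exponent `k + 3` from the recursion of `ζ` and `k + i + j + 2` from the derivative
    -- formula add up to `i + j` plus an odd number.
    have h : (-1 : ℝ) ^ ((i : ℕ) + j) * zeta (k + 2) +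
        (-1) ^ (k + 2 + 1) * zeta (k + 2) * (-1) ^ (k + 1 + (i : ℕ) + j + 1) = 0 := by
      have h1 : ((-1 : ℝ) ^ k) * (-1) ^ k = 1 := by rw [← mul_pow]; norm_num
      simp only [pow_add]
      linear_combination (-(-1 : ℝ) ^ (i : ℕ) * (-1) ^ (j : ℕ) * zeta (k + 2)) * h1
    rw [h, zero_smul]
  · rw [smul_zero, add_zero]

theorem obsBracket_cons_obsBracket_two (hw : IsNPlectic n w) {k : ℕ}
    (α : Fin 2 → DiffForm E M) (β : Fin (k + 1) → DiffForm E M) :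
    obsBracket n w (k + 2) (Fin.cons (obsBracket n w 2 α) β) = zeta (k + 2) •
      iterContract (Fin.cons (lie (obsField n w (α 0)) (obsField n w (α 1)))
        (fun b => obsField n w (β b)) : Fin (k + 2) → VField E M) w := by
  rw [obsBracket_add_two]
  congr 2
  funext a
  refine Fin.cases ?_ (fun a => ?_) a
  · rw [Fin.cons_zero, Fin.cons_zero, hw.obsField_obsBracket_two]
  · rw [Fin.cons_succ, Fin.cons_succ]

open Classical in
/-- The term of the generalized Jacobi identity with an inner operation of arity `m ≥ 3`. -/
theorem sum_isUnshuffle_last (hw : IsNPlectic n w) {k : ℕ} (d : Fin (k + 3) → ℤ)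
    (x : Fin (k + 3) → DiffForm E M) :
    ∑ σ : Equiv.Perm (Fin (k + 3)) with IsUnshuffle ((Fin.last (k + 2) : ℕ) + 1) σ,
      (Equiv.Perm.sign σ * koszulSign d σ * (-1) ^ (((Fin.last (k + 2) : ℕ) + 1) *
        (k + 3 - 1 - (Fin.last (k + 2) : ℕ))) : ℤˣ) •
      obsBracket n w (k + 3 - 1 - (Fin.last (k + 2) : ℕ) + 1)
        (Fin.cons (obsBracket n w ((Fin.last (k + 2) : ℕ) + 1)
            fun a : Fin ((Fin.last (k + 2) : ℕ) + 1) => x (σ ⟨a, by omega⟩))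
          fun b : Fin (k + 3 - 1 - (Fin.last (k + 2) : ℕ)) =>
            x (σ ⟨(Fin.last (k + 2) : ℕ) + 1 + b, by omega⟩)) =
      extD (obsBracket n w (k + 3) x) := by
  have hfilter : ({σ | IsUnshuffle ((Fin.last (k + 2) : ℕ) + 1) σ} :
      Finset (Equiv.Perm (Fin (k + 3)))) = {1} := by
    ext σ
    rw [Finset.mem_filter_univ, Finset.mem_singleton]
    exact isUnshuffle_self_iff σ
  have hk : (-1 : ℤˣ) ^ (((Fin.last (k + 2) : ℕ) + 1) *
      (k + 3 - 1 - (Fin.last (k + 2) : ℕ))) = 1 := by simp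
  rw [hfilter, Finset.sum_singleton, koszulSign_one, obsBracket_eq_of_eq_one (by simp),
    Equiv.Perm.sign_one, one_mul, one_mul, hk, one_smul]
  -- The outer `l_1` is the full `d` here, because the form degree of `l_m` is below `n - 1` for `m
  -- ≥ 3`.
  have h : degreeProj {p | p + 1 < n} (obsBracket n w (k + 3) x) = obsBracket n w (k + 3) x :=
    degreeProj_eq_self (hw.obsBracket_mem_formsOfDegree (by omega) x) fun p hp =>
      show p + 1 < n by push_cast at hp; omega
  exact congrArg extD h

open Classical in
/-- The terms of the generalized Jacobi identity with an inner operation of arity `2` cancel the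
term with an inner operation of arity `m ≥ 3`. -/
theorem sum_isUnshuffle_two_add (hw : IsNPlectic n w) {k : ℕ} (d : Fin (k + 3) → ℤ)
    (x : Fin (k + 3) → DiffForm E M) (hx : ∀ a, x a ∈ observables n w (d a)) :
    ∑ σ : Equiv.Perm (Fin (k + 3)) with IsUnshuffle 2 σ,
      (Equiv.Perm.sign σ * koszulSign d σ * (-1) ^ ((1 + 1) * (k + 3 - 1 - 1)) : ℤˣ) •
      obsBracket n w (k + 2) (Fin.cons (obsBracket n w 2 fun a : Fin 2 => x (σ ⟨a, by omega⟩))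
        fun b : Fin (k + 1) => x (σ ⟨1 + 1 + b, by omega⟩)) +
      extD (obsBracket n w (k + 3) x) = 0 := by
  have hidx : ∀ b : Fin (k + 1), (⟨1 + 1 + b, by omega⟩ : Fin (k + 3)) = b.succ.succ := fun b =>
    Fin.ext (by simp; omega)
  simp only [hidx]
  by_cases hd : ∀ a, d a = 0
  · rw [← hw.sum_bracketTerm_add_extD x]
    congr 1
    refine .trans ?_ ((sum_isUnshuffle_two fun σ => Equiv.Perm.sign σ • zeta (k + 2) •
      iterContract (Fin.cons (lie (obsField n w (x (σ 0))) (obsField n w (x (σ 1))))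
        (fun b : Fin (k + 1) => obsField n w (x (σ b.succ.succ))) :
          Fin (k + 2) → VField E M) w).trans ?_)
    · refine Finset.sum_congr rfl fun σ _ => ?_
      rw [koszulSign_of_forall_eq_zero hd, pow_mul, hw.obsBracket_cons_obsBracket_two]
      simp
    · simp only [sign_pairPerm, pairPerm_zero, pairPerm_one, pairPerm_succ_succ]
      rfl
  -- An argument of nonzero degree has zero field. It kills `l_m` and each unshuffle term, whether
  -- it enters the inner or the outer operation.
  · obtain ⟨a, ha⟩ := not_forall.1 hd
    have hxa := hw.obsField_eq_zero_of_mem_observables ha (hx a)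
    rw [obsBracket_eq_zero (by omega) x a hxa, map_zero, add_zero]
    refine Finset.sum_eq_zero fun σ _ => ?_
    obtain ⟨c, rfl⟩ := σ.surjective a
    have key : ∀ (u : ℤˣ) (α : Fin 2 → DiffForm E M) (β : Fin (k + 1) → DiffForm E M),
        ((∃ a, obsField n w (α a) = 0) ∨ ∃ b, obsField n w (β b) = 0) →
        u • obsBracket n w (k + 2) (Fin.cons (obsBracket n w 2 α) β) = 0 := by
      rintro u α β (⟨a, h⟩ | ⟨b, h⟩)
      · rw [obsBracket_eq_zero (by omega) (Fin.cons _ β) 0, smul_zero]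
        rw [Fin.cons_zero, obsBracket_eq_zero le_rfl α a h, hw.obsField_zero]
      · rw [obsBracket_eq_zero (by omega) (Fin.cons _ β) b.succ, smul_zero]
        rw [Fin.cons_succ, h]
    apply key
    by_cases hc : (c : ℕ) < 2
    · exact Or.inl ⟨⟨c, hc⟩, hxa⟩
    · have hc' : (⟨c - 2, by omega⟩ : Fin (k + 1)).succ.succ = c := Fin.ext (by simp; omega)
      exact Or.inr ⟨⟨c - 2, by omega⟩, by rw [hc']; exact hxa⟩

open Classical in
theorem jacobiator_obsBracket (hw : IsNPlectic n w) {m : ℕ} (hm : 1 ≤ m) (d : Fin m → ℤ)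
    (x : Fin m → DiffForm E M) (hx : ∀ a, x a ∈ observables n w (d a)) :
    jacobiator (obsBracket n w) d x = 0 := by
  rw [jacobiator]
  obtain rfl | rfl | ⟨k, rfl⟩ : m = 1 ∨ m = 2 ∨ ∃ k, m = k + 3 := by
    rcases m with _ | _ | _ | k
    · omega
    · exact Or.inl rfl
    · exact Or.inr (Or.inl rfl)
    · exact Or.inr (Or.inr ⟨k, rfl⟩)
  · refine Finset.sum_eq_zero fun i _ => Finset.sum_eq_zero fun σ _ => ?_
    obtain rfl : i = 0 := Subsingleton.elim _ _
    have h : ∀ (u : ℤˣ) (β : DiffForm E M), u • extD (degreeProj {p | p + 1 < n}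
        (extD (degreeProj {p | p + 1 < n} β))) = 0 := fun u β => by
      rw [degreeProj_extD, extD_extD, smul_zero]
    exact h _ _
  · refine Finset.sum_eq_zero fun i _ => Finset.sum_eq_zero fun σ _ => ?_
    fin_cases i
    · exact (congrArg _ (hw.obsBracket_cons_eq_zero (r := 1) (s := 1) le_rfl (by omega) le_rfl
        _ _)).trans (smul_zero _)
    -- `l_2` takes values in form degree `n - 1`, where `l_1` is zero by definition.
    · have h : ∀ (u : ℤˣ) (α : Fin 2 → DiffForm E M),
          u • extD (degreeProj {p | p + 1 < n} (obsBracket n w 2 α)) = 0 := fun u α => by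
        rw [degreeProj_eq_zero (hw.obsBracket_mem_formsOfDegree le_rfl α) fun p hp h => by
          have : p + 1 < n := h
          push_cast at hp
          omega]
        rw [map_zero, smul_zero]
      exact h _ _
  -- Indices are arities minus one: only the inner arities `2` and `m` survive.
  · rw [Fintype.sum_eq_add (⟨1, by omega⟩ : Fin (k + 3)) (Fin.last (k + 2))
      (by simp [Fin.ext_iff]) ?_]
    · rw [hw.sum_isUnshuffle_last]
      exact hw.sum_isUnshuffle_two_add d x hx
    · rintro i ⟨h1, h2⟩
      refine Finset.sum_eq_zero fun σ _ => ?_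
      have h3 : (i : ℕ) ≠ 1 := fun h => h1 (Fin.ext h)
      have h4 : (i : ℕ) ≠ k + 2 := fun h => h2 (Fin.ext h)
      have := i.2
      rw [hw.obsBracket_cons_eq_zero (by omega) (by omega) (by omega), smul_zero]

end IsNPlectic

end Jacobi

/-! ### The algebra of observables and its subalgebras -/

section Main

variable {E : Type*} [NormedAddCommGroup E] [NormedSpace ℝ E]
  {M : Type*} [TopologicalSpace M] [ChartedSpace E M] {n : ℕ}

theorem regrade_mono {S T : ℕ → Submodule ℝ (DiffForm E M)} (h : ∀ k, S k ≤ T k) (i : ℤ) :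
    regrade n S i ≤ regrade n T i := by
  rw [regrade, regrade]
  split_ifs
  · exact h _
  · exact le_rfl

theorem mem_regrade_zero {S : ℕ → Submodule ℝ (DiffForm E M)} (hn : 1 ≤ n) {α : DiffForm E M} :
    α ∈ regrade n S 0 ↔ α ∈ S 1 := by
  rw [regrade, if_pos (by omega)]
  rfl

variable [IsManifold 𝓘(ℝ, E) ∞ M] {w : DiffForm E M}

/-- An exact form is closed, so the zero multivector field serves. -/
theorem extD_mem_hamiltonianMultiForms {k : ℕ} {α : DiffForm E M}
    (hα : α ∈ formsOfDegree E M (n - (k + 1 : ℕ))) : extD α ∈ hamiltonianMultiForms n w k := by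
  rw [mem_hamiltonianMultiForms, extD_extD]
  refine ⟨?_, zero_mem _⟩
  have := extD_mem_formsOfDegree hα
  rwa [show (n : ℤ) - (k + 1 : ℕ) + 1 = n - k by push_cast; ring] at this

variable [FiniteDimensional ℝ E]

theorem observables_le_regrade (i : ℤ) :
    observables n w i ≤ regrade n (fun k => formsOfDegree E M (n - k)) i := by
  by_cases h : 0 ≤ i ∧ i ≤ n - 1
  · rw [regrade, if_pos h]
    refine (observables_le i).trans (le_of_eq ?_)
    congr 1
    push_cast
    omega
  · intro α hα
    rcases eq_or_ne i 0 with rfl | hi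
    · rw [eq_zero_of_mem_formsOfDegree (by omega) (observables_le 0 hα)]
      exact zero_mem _
    · rw [observables, if_neg hi, if_neg (by omega)] at hα
      rw [(Submodule.mem_bot ℝ).1 hα]
      exact zero_mem _

/-- Closure under `l_1`, stated for arbitrary source and target families to serve both Hamiltonian
and conserved forms. -/
theorem obsBracket_one_mem_regrade {S T : ℕ → Submodule ℝ (DiffForm E M)}
    (hS : ∀ k, S k ≤ formsOfDegree E M (n - k)) (hST : ∀ k, ∀ α ∈ S (k + 1), extD α ∈ T k)
    (d : Fin 1 → ℤ) (x : Fin 1 → DiffForm E M) (hx : ∀ a, x a ∈ regrade n S (d a)) :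
    obsBracket n w 1 x ∈ regrade n T ((∑ a, d a) + (1 : ℕ) - 2) := by
  have hx0 := hx 0
  rw [obsBracket_one, Fin.sum_univ_one]
  generalize d 0 = j at hx0
  generalize x 0 = α at hx0
  rw [regrade] at hx0
  split_ifs at hx0 with hj
  · rcases eq_or_ne j 0 with rfl | hj0
    · rw [degreeProj_eq_zero (hS _ hx0) fun p hp h => by
        have : p + 1 < n := h
        simp at hp
        omega]
      rw [map_zero]
      exact zero_mem _
    · rw [degreeProj_eq_self (S := {p | p + 1 < n}) (hS _ hx0) fun p hp =>
        show p + 1 < n by push_cast at hp; omega]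
      rw [regrade, if_pos (by push_cast; omega)]
      refine hST _ _ ?_
      convert hx0 using 2
      push_cast
      omega
  · rw [(Submodule.mem_bot ℝ).1 hx0, map_zero, map_zero]
    exact zero_mem _

theorem strictlyConserved_le (X : VField E M) (k : ℕ) :
    strictlyConserved n w X k ≤ globallyConserved n w X k := by
  rintro α ⟨hα, hX⟩
  refine ⟨hα, ?_⟩
  change lieDeriv X α ∈ (formsOfDegree E M (n - k - 1)).map extD
  rw [LinearMap.mem_ker.1 hX]
  exact zero_mem _

theorem globallyConserved_le (X : VField E M) (k : ℕ) :
    globallyConserved n w X k ≤ locallyConserved n w X k := by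
  rintro α ⟨hα, β, -, hβ⟩
  refine ⟨hα, ?_⟩
  change extD (lieDeriv X α) = 0
  rw [← hβ, extD_extD]

theorem hamiltonianObservables_le (i : ℤ) :
    hamiltonianObservables n w i ≤ observables n w i := by
  rw [hamiltonianObservables, regrade]
  split_ifs with h
  · rcases eq_or_ne i 0 with rfl | hi
    · rw [observables, if_pos rfl]
      exact hamiltonianMultiForms_one_le n w
    · rw [observables, if_neg hi, if_pos (by omega)]
      intro α hα
      convert hα.1 using 2
      push_cast
      omega
  · exact bot_le

/-- Multilinearity is required on inhomogeneous sums too, where only the component of form degree `n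
- 1` is Hamiltonian. -/
theorem degreeProj_mem_hamiltonianForms {α : DiffForm E M} (hα : α ∈ ⨆ i, observables n w i) :
    degreeProj {p | p + 1 = n} α ∈ hamiltonianForms n w := by
  have h : ⨆ i, observables n w i ≤
      (hamiltonianForms n w).comap (degreeProj {p | p + 1 = n}) := by
    refine iSup_le fun i β hβ => ?_
    rw [Submodule.mem_comap]
    rcases eq_or_ne i 0 with rfl | hi
    · rw [observables, if_pos rfl] at hβ
      rwa [degreeProj_eq_self (S := {p | p + 1 = n}) hβ.1 fun p hp =>
        show p + 1 = n by omega]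
    · rw [degreeProj_eq_zero (observables_le i hβ) fun p hp h => hi (by
        have : p + 1 = n := h
        omega)]
      exact zero_mem _
  exact h hα

namespace IsNPlectic

/-- Uniqueness of Hamiltonian fields gives linearity. Membership in the span matters, since the
default value `0` for other forms need not be additive. -/
theorem obsField_smul_add (hw : IsNPlectic n w) (c : ℝ) {α β : DiffForm E M}
    (hα : α ∈ ⨆ i, observables n w i) (hβ : β ∈ ⨆ i, observables n w i) :
    obsField n w (c • α + β) = c • obsField n w α + obsField n w β := by
  have h1 := hw.isHamiltonianVField_obsField (degreeProj_mem_hamiltonianForms hα)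
  have h2 := hw.isHamiltonianVField_obsField (degreeProj_mem_hamiltonianForms hβ)
  have hp : ∀ γ : DiffForm E M, obsField n w (degreeProj {p | p + 1 = n} γ) = obsField n w γ := by
    intro γ
    rw [obsField, obsField]
    congr 1
    refine DiffForm.ext fun x p => ?_
    by_cases hp : p + 1 = n
    · rw [degreeProj_val_of_mem (S := {p | p + 1 = n}) hp]
    · rw [degreeProj_val_of_notMem (S := {p | p + 1 = n}) hp,
        degreeProj_val_of_notMem (S := {p | p + 1 = n}) hp]
  rw [hp] at h1 h2
  refine hw.hamVField_eq ?_
  rw [IsHamiltonianVField] at h1 h2 ⊢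
  rw [map_add, map_smul, map_add, map_smul, h1, h2]
  have h : contract (c • obsField n w α + obsField n w β) w =
      c • contract (obsField n w α) w + contract (obsField n w β) w :=
    Subtype.ext <| funext fun x => by
      refine (LinearMap.congr_fun (map_add (contractVec (E := E))
        (c • evalAt x (obsField n w α)) (evalAt x (obsField n w β))) (w.1 x)).trans ?_
      rw [map_smul]
      rfl
  rw [h, smul_neg, neg_add]

theorem obsBracket_mem_regrade_of_mem (hw : IsNPlectic n w) {k : ℕ} (d : Fin (k + 2) → ℤ)
    (x : Fin (k + 2) → DiffForm E M) (hx : ∀ a, x a ∈ observables n w (d a))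
    (S : ℕ → Submodule ℝ (DiffForm E M))
    (hS : (∀ a, d a = 0) → obsBracket n w (k + 2) x ∈ regrade n S k) :
    obsBracket n w (k + 2) x ∈ regrade n S ((∑ a, d a) + (k + 2 : ℕ) - 2) := by
  by_cases hd : ∀ a, d a = 0
  · convert hS hd using 2
    simp [hd]
  · obtain ⟨a, ha⟩ := not_forall.1 hd
    rw [obsBracket_eq_zero (by omega) x a (hw.obsField_eq_zero_of_mem_observables ha (hx a))]
    exact zero_mem _

theorem obsBracket_mem_hamiltonianObservables (hw : IsNPlectic n w) {k : ℕ} (hk : 1 ≤ k)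
    (d : Fin k → ℤ) (x : Fin k → DiffForm E M) (hx : ∀ a, x a ∈ observables n w (d a)) :
    obsBracket n w k x ∈ hamiltonianObservables n w ((∑ a, d a) + k - 2) := by
  rcases k with _ | _ | k
  · omega
  · exact obsBracket_one_mem_regrade (fun _ => le_rfl)
      (fun _ _ => extD_mem_hamiltonianMultiForms) d x fun a => observables_le_regrade _ (hx a)
  · exact hw.obsBracket_mem_regrade_of_mem d x hx _ fun _ => hw.obsBracket_mem_regrade x

theorem isLInftyAlgebra_observables (hw : IsNPlectic n w) :
    IsLInftyAlgebra (observables n w) (obsBracket n w) where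
  independent := (iSupIndep_formsOfDegree.comp (f := fun i : ℤ => (n : ℤ) - 1 - i)
    (fun i j h => by simpa using h)).mono observables_le
  degree _ hk d x hx :=
    hamiltonianObservables_le _ (hw.obsBracket_mem_hamiltonianObservables hk d x hx)
  multilinear := by
    intro k hk x hx a y hy z hz c
    rcases k with _ | _ | k
    · omega
    · obtain rfl : a = (0 : Fin 1) := Subsingleton.elim (α := Fin 1) _ _
      change obsBracket n w 1 _ = c • obsBracket n w 1 _ + obsBracket n w 1 _
      simp only [obsBracket_one, Function.update_self, map_add, map_smul]
    · have h : ∀ v, (fun b => obsField n w (Function.update x a v b)) =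
          Function.update (fun b => obsField n w (x b)) a (obsField n w v) := fun v =>
        funext fun b => Function.apply_update (fun _ => obsField n w) x a v b
      simp only [obsBracket_add_two, h, hw.obsField_smul_add c hy hz,
        ← iterContractAlt_apply, AlternatingMap.map_update_add, AlternatingMap.map_update_smul,
        smul_add]
      rw [smul_comm]
  skew := by
    intro k hk d x hx σ
    rcases k with _ | _ | k
    · omega
    · obtain rfl : σ = 1 := Subsingleton.elim (α := Equiv.Perm (Fin 1)) _ _
      rw [koszulSign_one, Equiv.Perm.sign_one, one_mul, one_smul]
      rfl
    · by_cases hd : ∀ a, d a = 0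
      · rw [koszulSign_of_forall_eq_zero hd, mul_one, obsBracket_add_two, obsBracket_add_two,
          iterContract_perm fun a => obsField n w (x a), smul_comm]
      · obtain ⟨a, ha⟩ := not_forall.1 hd
        have hxa := hw.obsField_eq_zero_of_mem_observables ha (hx a)
        rw [obsBracket_eq_zero (by omega) x a hxa, smul_zero]
        exact obsBracket_eq_zero (by omega) _ (σ.symm a) (by rwa [σ.apply_symm_apply])
  jacobi := fun m hm d x hx => hw.jacobiator_obsBracket hm d x hx

theorem isLieNAlgebra_observables (hw : IsNPlectic n w) (hn : 1 ≤ n) :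
    IsLieNAlgebra n (observables n w) (obsBracket n w) where
  toIsLInftyAlgebra := hw.isLInftyAlgebra_observables
  eq_bot i hi := by
    rw [observables, if_neg (by omega), if_neg (by omega)]

/-- The Lie bracket of `X` with the Hamiltonian vector field of a form that is locally conserved
along `X` vanishes. -/
theorem lie_eq_zero_of_conserved (hw : IsNPlectic n w) {X Y : VField E M} {α : DiffForm E M}
    (hX : lieDeriv X w = 0) (hY : IsHamiltonianVField w α Y) (hα : extD (lieDeriv X α) = 0) :
    lie X Y = 0 := by
  apply hw.eq_zero_of_contract_eq_zero
  have h := lieDeriv_contract X Y w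
  rw [hX, map_zero, zero_add] at h
  rw [IsHamiltonianVField] at hY
  -- `[X, Y] ⌟ ω = 𝓛_X (Y ⌟ ω) = -𝓛_X dα = -d 𝓛_X α = 0`.
  rw [← h, ← neg_neg (contract Y w), ← hY, map_neg, ← extD_lieDeriv, hα, neg_zero]

/-- The operations map locally conserved Hamiltonian forms to strictly conserved ones. -/
theorem obsBracket_mem_strictlyConserved (hw : IsNPlectic n w) (hn : 1 ≤ n) {X : VField E M}
    (hX : lieDeriv X w = 0) {k : ℕ} (hk : 1 ≤ k) (d : Fin k → ℤ) (x : Fin k → DiffForm E M)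
    (hx : ∀ a, x a ∈ regrade n (locallyConserved n w X) (d a)) :
    obsBracket n w k x ∈ regrade n (strictlyConserved n w X) ((∑ a, d a) + k - 2) := by
  rcases k with _ | _ | k
  · omega
  · refine obsBracket_one_mem_regrade (fun k α (hα : α ∈ locallyConserved n w X k) => hα.1.1)
      (fun k α hα => ?_) d x hx
    refine ⟨extD_mem_hamiltonianMultiForms hα.1.1, ?_⟩
    change lieDeriv X (extD α) = 0
    rw [← extD_lieDeriv]
    exact hα.2
  · refine hw.obsBracket_mem_regrade_of_mem d x
      (fun a => hamiltonianObservables_le _ (regrade_mono (fun _ => inf_le_left) _ (hx a))) _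
      fun hd => ?_
    have hbr := hw.obsBracket_mem_regrade x
    rw [regrade] at hbr ⊢
    split_ifs at hbr ⊢
    · refine ⟨hbr, ?_⟩
      have hlie : ∀ a, lie X (obsField n w (x a)) = 0 := fun a => by
        have hxa := hx a
        rw [hd a, mem_regrade_zero hn] at hxa
        exact hw.lie_eq_zero_of_conserved hX
          (hw.isHamiltonianVField_obsField (hamiltonianMultiForms_one_le n w hxa.1)) hxa.2
      change lieDeriv X (obsBracket n w (k + 2) x) = 0
      -- By the Leibniz rule, `𝓛_X` either falls on `ω` or replaces one field by its bracket with
      -- `X`; both vanish.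
      rw [obsBracket_add_two, map_smul, lieDeriv_iterContract, hX,
        iterContract_form_zero, zero_add, Finset.sum_eq_zero, smul_zero]
      intro a _
      rw [hlie]
      exact iterContract_of_eq_zero w (i := a) (Function.update_self _ _ _)
    · exact hbr

theorem isLInftySubalgebra_hamiltonianObservables (hw : IsNPlectic n w) :
    IsLInftySubalgebra (hamiltonianObservables n w) (observables n w) (obsBracket n w) where
  ambient := hw.isLInftyAlgebra_observables
  le := hamiltonianObservables_le
  closed _ hk d x hx := hw.obsBracket_mem_hamiltonianObservables hk d x fun a =>
    hamiltonianObservables_le _ (hx a)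

/-- Arguments in `S` are locally conserved, so the values are strictly conserved and lie in `S`
again. The three notions of conservation are instances of this sandwich. -/
theorem isLInftySubalgebra_of_le_locallyConserved (hw : IsNPlectic n w) (hn : 1 ≤ n)
    {X : VField E M} (hX : lieDeriv X w = 0) {S : ℕ → Submodule ℝ (DiffForm E M)}
    (hS : ∀ k, strictlyConserved n w X k ≤ S k) (hS' : ∀ k, S k ≤ locallyConserved n w X k) :
    IsLInftySubalgebra (regrade n S) (hamiltonianObservables n w) (obsBracket n w) where
  ambient := hw.isLInftyAlgebra_observables.restrict hamiltonianObservables_le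
    hw.isLInftySubalgebra_hamiltonianObservables.closed
  le := regrade_mono fun k => (hS' k).trans inf_le_left
  closed _ hk d x hx := regrade_mono hS _ <| hw.obsBracket_mem_strictlyConserved hn hX hk d x
    fun a => regrade_mono hS' _ (hx a)

end IsNPlectic

end Main

end Multisymplectic

end

theorem mainTheorem12
    {E : Type*} [NormedAddCommGroup E] [NormedSpace ℝ E] [FiniteDimensional ℝ E]
    {M : Type*} [TopologicalSpace M] [T2Space M] [SigmaCompactSpace M]
    [ChartedSpace E M] [IsManifold 𝓘(ℝ, E) ∞ M]
    (n : ℕ) (hn : 1 ≤ n) (w : Multisymplectic.DiffForm E M) (hw : Multisymplectic.IsNPlectic n w) :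
    Multisymplectic.IsLieNAlgebra n
      (Multisymplectic.observables n w) (Multisymplectic.obsBracket n w) ∧
    Multisymplectic.IsLInftySubalgebra
      (Multisymplectic.hamiltonianObservables n w)
      (Multisymplectic.observables n w) (Multisymplectic.obsBracket n w) ∧
    ∀ H ∈ Multisymplectic.hamiltonianForms n w, ∀ XH : Multisymplectic.VField E M,
      Multisymplectic.IsHamiltonianVField w H XH →
      Multisymplectic.IsLInftySubalgebra
        (Multisymplectic.regrade n (Multisymplectic.globallyConserved n w XH))
        (Multisymplectic.hamiltonianObservables n w) (Multisymplectic.obsBracket n w) ∧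
      Multisymplectic.IsLInftySubalgebra
        (Multisymplectic.regrade n (Multisymplectic.locallyConserved n w XH))
        (Multisymplectic.hamiltonianObservables n w) (Multisymplectic.obsBracket n w) ∧
      Multisymplectic.IsLInftySubalgebra
        (Multisymplectic.regrade n (Multisymplectic.strictlyConserved n w XH))
        (Multisymplectic.hamiltonianObservables n w) (Multisymplectic.obsBracket n w) := by
  refine ⟨hw.isLieNAlgebra_observables hn, hw.isLInftySubalgebra_hamiltonianObservables, ?_⟩
  intro H _ XH hXH
  have hX := hw.lieDeriv_of_isHamiltonianVField hXH
  have hsg := Multisymplectic.strictlyConserved_le (n := n) (w := w) XH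
  have hgl := Multisymplectic.globallyConserved_le (n := n) (w := w) XH
  exact ⟨hw.isLInftySubalgebra_of_le_locallyConserved hn hX hsg hgl,
    hw.isLInftySubalgebra_of_le_locallyConserved hn hX (fun k => (hsg k).trans (hgl k))
      fun _ => le_rfl,
    hw.isLInftySubalgebra_of_le_locallyConserved hn hX (fun _ => le_rfl)
      fun k => (hsg k).trans (hgl k)⟩
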